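/- Let $\mathbb M$ be four-dimensional Minkowski spacetime with metric $g$ of signature $(-,+,+,+)$, translation space $\mathsf V$ and open cone $\mathsf V_+\subset\mathsf V$ of future-directed timelike vectors. A spacelike 3-plane is an affine 3-plane in $\mathbb M$ all of whose nonzero tangent vectors $w$ satisfy $g(w,w)>0$. Let $\mathcal R$ be the family of all Borel subsets of all spacelike 3-planes of $\mathbb M$. Let $G$ be either the orthochronous Poincaré group $IO(1,3)_+$, with $\pi=\mathrm{id}$, or the universal covering of the proper orthochronous Poincaré group, $\pi:G\to ISO(1,3)_+$. A relativistic spatial localization observable consists of a complex Hilbert space $\mathcal H\neq\{0\}$; a set $\mathsf S$ of tensors over $\mathsf V$ of a fixed order that is invariant under the action of $\pi(G)$, which acts on tensors through the linear parts; a strongly continuous unitary representation $U$ of $G$ on $\mathcal H$; and maps $A^v:\mathcal R\to\mathfrak B(\mathcal H)$, $v\in\mathsf S$, such that (i) for every $v\in\mathsf S$ and every spacelike 3-plane $\Sigma$, the restriction of $A^v$ to the Borel subsets of $\Sigma$ is a normalized POVM: $0\le A^v(\Delta)\le I$, $A^v(\Sigma)=I$, and $\Delta\mapsto\langle\psi|A^v(\Delta)\psi\rangle$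 is $\sigma$-additive for every $\psi\in\mathcal H$; (ii) $U_gA^v(\Delta)U_g^{-1}=A^{\pi(g)v}(\pi(g)\Delta)$ for all $g\in G$, $v\in\mathsf S$, $\Delta\in\mathcal R$. For $u\in\mathsf V_+$, the translations by $tu$ ($t\in\mathbb R$) form a one-parameter subgroup of $IO(1,3)_+$, which lifts uniquely to a continuous one-parameter subgroup $t\mapsto\gamma_u(t)$ of $G$; let $H_u$ be the self-adjoint generator of $t\mapsto U_{\gamma_u(t)}=e^{-itH_u}$. **Claim.** Suppose that for some $u_0\in\mathsf V_+$ the spectrum of $H_{u_0}$ is bounded from below. Then, for every $v\in\mathsf S$ and every foliation $\mathcal F$ of $\mathbb M$ by parallel spacelike 3-planes, the following microcausality condition fails: for all bounded Borel sets $\Delta,\Delta'$ that lie in a common leaf of $\mathcal F$, are disjoint and have strictly positive distance in that leaf, and for every $u\in\mathsf V_+$, there is $\delta>0$ such that $$[A^v(\Delta),A^v(\Delta'+tu)]=0\qquad\text{for } 0\le t<\delta .$$ -/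

import Mathlib

open scoped TensorProduct Pointwise

noncomputable section

namespace Minkowski

/-! ### Minkowski spacetime and its symmetry groups -/

/-- Minkowski spacetime in Minkowskian coordinates (the index `0` is time, `c = 1`). The same type
serves as the affine space of events and as its space of translations. -/
abbrev Spacetime : Type := Fin 4 → ℝ

/-- The Minkowski metric, of signature `(-,+,+,+)`. -/
def metric (x y : Spacetime) : ℝ :=
  -(x 0 * y 0) + x 1 * y 1 + x 2 * y 2 + x 3 * y 3

/-- The open cone `V₊` of future-directed timelike vectors. -/
def FutureTimelike (x : Spacetime) : Prop :=
  metric x x < 0 ∧ 0 < x 0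

/-- Spacelike affine 3-planes: every nonzero tangent vector is spacelike. -/
def IsSpacelikePlane (P : AffineSubspace ℝ Spacetime) : Prop :=
  Module.finrank ℝ P.direction = 3 ∧ ∀ w ∈ P.direction, w ≠ 0 → 0 < metric w w

/-- The orthochronous Poincaré group `IO(1,3)₊`: the affine bijections of spacetime which preserve
the metric and the time orientation. -/
def OrthochronousPoincare : Subgroup (Spacetime ≃ᵃ[ℝ] Spacetime) where
  carrier := {h | (∀ x y, metric (h.linear x) (h.linear y) = metric x y) ∧
    ∀ x, FutureTimelike (h.linear x) ↔ FutureTimelike x}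
  one_mem' := ⟨fun _ _ => rfl, fun _ => Iff.rfl⟩
  mul_mem' := by
    rintro a b ⟨ha, ha'⟩ ⟨hb, hb'⟩
    exact ⟨fun x y => (ha _ _).trans (hb x y), fun x => (ha' _).trans (hb' x)⟩
  inv_mem' := by
    rintro a ⟨ha, ha'⟩
    have key : ∀ x, a.linear ((a⁻¹).linear x) = x := fun x => a.linear.apply_symm_apply x
    exact ⟨fun x y => by rw [← ha, key, key], fun x => by rw [← ha', key]⟩

/-- The topology of the Poincaré group. On affine maps of a finite-dimensional space, pointwise
convergence is the usual (Lie group) topology of pairs (linear part, translation part). -/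
instance : TopologicalSpace OrthochronousPoincare :=
  TopologicalSpace.induced (fun h (p : Spacetime) => h.1 p) inferInstance

/-- The proper orthochronous Poincaré group `ISO(1,3)₊`. -/
def ProperPoincare : Subgroup OrthochronousPoincare where
  carrier := {h | 0 < LinearMap.det (h.1.linear : Spacetime →ₗ[ℝ] Spacetime)}
  one_mem' := by
    change 0 < LinearMap.det (LinearMap.id : Spacetime →ₗ[ℝ] Spacetime)
    simp
  mul_mem' := by
    intro a b ha hb
    change 0 < LinearMap.det ((a.1.linear : Spacetime →ₗ[ℝ] Spacetime) ∘ₗ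
      (b.1.linear : Spacetime →ₗ[ℝ] Spacetime))
    rw [LinearMap.det_comp]
    exact mul_pos ha hb
  inv_mem' := by
    intro a ha
    have h : LinearMap.det (a.1.linear : Spacetime →ₗ[ℝ] Spacetime) *
        LinearMap.det (a.1.linear.symm : Spacetime →ₗ[ℝ] Spacetime) = 1 :=
      LinearEquiv.det_mul_det_symm _
    change 0 < LinearMap.det (a.1.linear.symm : Spacetime →ₗ[ℝ] Spacetime)
    exact pos_of_mul_pos_right (h ▸ one_pos) (le_of_lt ha)

/-- The translation `x ↦ a + x` as an element of the Poincaré group. -/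
def translation (a : Spacetime) : OrthochronousPoincare :=
  ⟨AffineEquiv.constVAdd ℝ Spacetime a, fun _ _ => rfl, fun _ => Iff.rfl⟩

/-- `π` exhibits the topological group `G` as the universal covering of the proper orthochronous
Poincaré group: it is a covering homomorphism onto that group, with `G` simply connected. -/
def IsUniversalCover {G : Type*} [Group G] [TopologicalSpace G]
    (π : G →* OrthochronousPoincare) : Prop :=
  SimplyConnectedSpace G ∧ π.range = ProperPoincare ∧ IsCoveringMap π.rangeRestrict

/-- The two symmetry groups that are admitted, each with its homomorphism to `IO(1,3)₊`:
`IO(1,3)₊` itself, or the universal covering of `ISO(1,3)₊`. -/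
def IsSymmetryGroup {G : Type*} [Group G] [TopologicalSpace G]
    (π : G →* OrthochronousPoincare) : Prop :=
  IsHomeomorph π ∨ IsUniversalCover π

/-- Tensors of order `(p, q)` over the space of translations. -/
abbrev Tensor (p q : ℕ) : Type :=
  (⨂[ℝ]^p Spacetime) ⊗[ℝ] (⨂[ℝ]^q (Module.Dual ℝ Spacetime))

/-- The action of the Poincaré group on tensors, through the linear part `L`: vectors transform
with `L`, covectors with the inverse transpose of `L`. -/
def tensorAction {p q : ℕ} (h : OrthochronousPoincare) : Tensor p q →ₗ[ℝ] Tensor p q :=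
  TensorProduct.map
    (PiTensorProduct.map fun _ => (h.1.linear : Spacetime →ₗ[ℝ] Spacetime))
    (PiTensorProduct.map fun _ => (h.1.linear.symm : Spacetime →ₗ[ℝ] Spacetime).dualMap)

/-! ### Operators in Hilbert space -/

section Operators

variable {H : Type*} [NormedAddCommGroup H] [InnerProductSpace ℂ H]

/-- `E` restricts to a normalized POVM on the Borel `σ`-algebra of `X`, for a Borel set `X` of
spacetime. The values of `E` at other sets play no role. -/
structure IsPOVM (X : Set Spacetime) (E : Set Spacetime → H →L[ℂ] H) : Prop where
  nonneg : ∀ B ⊆ X, MeasurableSet B → 0 ≤ E B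
  le_one : ∀ B ⊆ X, MeasurableSet B → E B ≤ 1
  normalized : E X = 1
  sigma_additive : ∀ B : ℕ → Set Spacetime, (∀ n, B n ⊆ X) → (∀ n, MeasurableSet (B n)) →
    Pairwise (Function.onFun Disjoint B) →
    ∀ ψ : H, HasSum (fun n => inner ℂ ψ (E (B n) ψ)) (inner ℂ ψ (E (⋃ n, B n) ψ))

/-- The generator `K` of a one-parameter group `W t = exp (-i t K)`: its domain consists of the
vectors at which `t ↦ W t ψ` is differentiable at `0`, and `K ψ = i (d/dt) W t ψ` at `t = 0`. It is
self-adjoint if `W` is a strongly continuous unitary group. -/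
def generator (W : ℝ → H →L[ℂ] H) : H →ₗ.[ℂ] H where
  domain :=
    { carrier := {ψ | DifferentiableAt ℝ (fun t => W t ψ) 0}
      zero_mem' := by simp
      add_mem' := by
        intro a b ha hb
        simp only [Set.mem_ofPred_eq, map_add] at *
        exact ha.fun_add hb
      smul_mem' := by
        intro c a ha
        simp only [Set.mem_ofPred_eq, map_smul] at *
        exact ha.fun_const_smul c }
  toFun :=
    { toFun := fun ψ => Complex.I • deriv (fun t => W t (ψ : H)) 0
      map_add' := by
        rintro ⟨a, ha⟩ ⟨b, hb⟩
        have h : deriv (fun t => W t (a + b)) 0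
            = deriv (fun t => W t a) 0 + deriv (fun t => W t b) 0 := by
          simp only [map_add]
          exact deriv_fun_add ha hb
        change Complex.I • deriv (fun t => W t (a + b)) 0 = _
        rw [h, smul_add]
      map_smul' := by
        rintro c ⟨a, ha⟩
        have h : deriv (fun t => W t (c • a)) 0 = c • deriv (fun t => W t a) 0 := by
          simp only [map_smul]
          exact deriv_fun_const_smul c ha
        change Complex.I • deriv (fun t => W t (c • a)) 0 = c • Complex.I • _
        rw [h, smul_comm] }

/-- The spectrum of an unbounded operator `T`: the complement of the set of those `z` for which
`T - z` is a bijection from the domain of `T` onto `H` with bounded inverse `R`. -/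
def unboundedSpectrum (T : H →ₗ.[ℂ] H) : Set ℂ :=
  {z | ¬ ∃ R : H →L[ℂ] H,
    (∀ ψ : H, ∃ hψ : R ψ ∈ T.domain, T ⟨R ψ, hψ⟩ - z • R ψ = ψ) ∧
    ∀ ψ : T.domain, R (T ψ - z • (ψ : H)) = ψ}

end Operators

/-! ### Relativistic spatial localization observables -/

/-- Relativistic spatial localization observables on `H`, covariant under the symmetry group `G`.
The family `ℛ` of regions consists of the Borel subsets of the spacelike 3-planes. The effects
`A v Δ` are meaningful for `v ∈ S` and `Δ ∈ ℛ` only, and nothing is required elsewhere. -/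
structure LocalizationObservable {G : Type*} [Group G] [TopologicalSpace G]
    (π : G →* OrthochronousPoincare)
    (H : Type*) [NormedAddCommGroup H] [InnerProductSpace ℂ H] [CompleteSpace H] where
  /-- contravariant order of the index tensors -/
  p : ℕ
  /-- covariant order of the index tensors -/
  q : ℕ
  /-- the invariant set of tensors that index the effects -/
  S : Set (Tensor p q)
  S_invariant : ∀ g : G, ∀ v ∈ S, tensorAction (π g) v ∈ S
  /-- the effects -/
  A : Tensor p q → Set Spacetime → H →L[ℂ] H
  povm : ∀ v ∈ S, ∀ P : AffineSubspace ℝ Spacetime, IsSpacelikePlane P →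
    IsPOVM (P : Set Spacetime) (A v)
  /-- the unitary representation -/
  U : G →* unitary (H →L[ℂ] H)
  strongly_continuous : ∀ ψ : H, Continuous fun g => (U g : H →L[ℂ] H) ψ
  covariant : ∀ g : G, ∀ v ∈ S, ∀ P : AffineSubspace ℝ Spacetime, IsSpacelikePlane P →
    ∀ Δ : Set Spacetime, Δ ⊆ P → MeasurableSet Δ →
      (U g : H →L[ℂ] H) * A v Δ * ((U g)⁻¹ : unitary (H →L[ℂ] H))
        = A (tensorAction (π g) v) ((fun x => (π g).1 x) '' Δ)

/-- The self-adjoint generator of the time translations `t ↦ U (t u)` has spectrum bounded from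
below. In a covering group the translations `t u` are represented by their (unique) lift `γ` to a
continuous one-parameter subgroup. -/
def EnergyBoundedBelow {G : Type*} [Group G] [TopologicalSpace G]
    (π : G →* OrthochronousPoincare)
    {H : Type*} [NormedAddCommGroup H] [InnerProductSpace ℂ H] [CompleteSpace H]
    (U : G →* unitary (H →L[ℂ] H)) (u : Spacetime) : Prop :=
  ∃ γ : Multiplicative ℝ →* G, Continuous γ ∧
    (∀ t : ℝ, π (γ (Multiplicative.ofAdd t)) = translation (t • u)) ∧
    BddBelow {E : ℝ | (E : ℂ) ∈
      unboundedSpectrum (generator fun t => (U (γ (Multiplicative.ofAdd t)) : H →L[ℂ] H))}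

/-- Microcausality of a family of effects `B`, for the bounded Borel regions in the leaves of the
foliation of spacetime by the 3-planes parallel to `P₀`: if `Δ` and `Δ'` are disjoint, lie in a
common leaf, and have strictly positive distance `≥ d` (in the metric of the leaf), then for each
`u ∈ V₊` there is `δ > 0` such that `B Δ` and `B (Δ' + t u)` commute for `0 ≤ t < δ`. -/
def Microcausal {H : Type*} [NormedAddCommGroup H] [InnerProductSpace ℂ H]
    (P₀ : AffineSubspace ℝ Spacetime) (B : Set Spacetime → H →L[ℂ] H) : Prop :=
  ∀ P : AffineSubspace ℝ Spacetime, P.Parallel P₀ →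
    ∀ Δ Δ' : Set Spacetime, Δ ⊆ P → Δ' ⊆ P →
      MeasurableSet Δ → MeasurableSet Δ' → Bornology.IsBounded Δ → Bornology.IsBounded Δ' →
      Disjoint Δ Δ' →
      (∃ d > 0, ∀ x ∈ Δ, ∀ y ∈ Δ', d ≤ √(metric (x - y) (x - y))) →
      ∀ u : Spacetime, FutureTimelike u →
        ∃ δ > 0, ∀ t : ℝ, 0 ≤ t → t < δ → Commute (B Δ) (B ((t • u) +ᵥ Δ'))

end Minkowski

end

/-!
Suppose that the microcausality condition holds for the leaf `P`. The contradiction arises from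
spectral cut-offs of the effects of a large bounded region `Δ ⊆ P`.

By normalization, `A(Δ)` has spectrum above `3/4` if `Δ` is large, so that a cut-off
`e(Δ) = (A(Δ) - 3/4)₊` is not `0` (`IsPOVM.exists_cfc_excess_ne_zero`). If `Δ + a` is a translate
inside `P`, disjoint from `Δ`, then `A(Δ) + A(Δ + a) ≤ 1` and the two effects commute, hence
`e(Δ) e(Δ + a) = 0` (`cfc_plateau_mul_cfc_excess`). By microcausality, `e(Δ)` commutes with the
translates `e(Δ + a + t u)` for small `t`. Since the energy is bounded from below, Borchers' lemma
(`IsPositiveGroup.mul_conj_eq_zero_of_commute`) gives `e(Δ) e(Δ + a + t u) = 0` for *all* `t`,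
whenever `a` is a large enough vector in the direction of `P`
(`Microcausal.cfc_excess_mul_cfc_excess`).

Now let `w = Λ u = a + k u` be a Lorentz transform of `u` that is not parallel to it. Then
`s w = s a + s k u` has a large component in `P` for large `s`, so that `e(Δ) e(Δ + s w) = 0`. In
terms of the unitary group `V` of the translations along `w`, this says `e(Δ) V(s) e(Δ) = 0` for
large `s`. The group `V` is unitarily equivalent to the one along `u`, so `s ↦ e(Δ) V(s) e(Δ)` is
the boundary value of a holomorphic function on the lower half plane; it vanishes on an interval,
therefore also at `s = 0`, which gives `e(Δ)² = 0`, a contradiction.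

The unbounded generator `K` of the translations along `u` enters only through its resolvent. After
a shift of the energy, the resolvent set contains `(-∞, 0]`, which makes `R = K⁻¹` a bounded
positive operator (`IsResolvent.nonneg`). The operators `exp (-i z K)` for `z` in the lower half
plane are then obtained by the continuous functional calculus of `R`, as the functions
`x ↦ exp (-i z / x)` are continuous on `[0, ∞)`; a uniqueness argument for the Schrödinger equation
(`IsPositiveGroup.eq_apply_of_hasDerivAt`) shows that they extend the given group.

Borchers' lemma rests on a Schwarz lemma for functions with many zeros
(`Complex.eq_zero_of_approx_zeros`): the commutation relations allow the gluing of holomorphic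
functions on both sides of the real axis, and products of translates of one operator produce the
zeros.
-/

/-! ### Holomorphic functions glued along the real axis -/

namespace Complex

section Gluing

variable {E : Type*} [NormedAddCommGroup E] [NormedSpace ℂ E]

lemma integral_boundary_rect_eq_zero_of_im_ne_zero {f : ℂ → E} {U : Set ℂ} (hf : ContinuousOn f U)
    (hd : ∀ z ∈ U, z.im ≠ 0 → DifferentiableAt ℂ f z) {z w : ℂ} (hzw : Rectangle z w ⊆ U)
    (h0 : ∀ y ∈ Set.Ioo (min z.im w.im) (max z.im w.im), y ≠ 0) :
    (∫ x : ℝ in z.re..w.re, f (x + z.im * I)) - (∫ x : ℝ in z.re..w.re, f (x + w.im * I)) +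
      I • (∫ y : ℝ in z.im..w.im, f (re w + y * I)) -
      I • (∫ y : ℝ in z.im..w.im, f (re z + y * I)) = 0 := by
  refine integral_boundary_rect_eq_zero_of_continuousOn_of_differentiableOn f z w (hf.mono hzw) ?_
  intro x hx
  refine (hd x (hzw ⟨?_, ?_⟩) (h0 _ hx.2)).differentiableWithinAt
  · exact Set.Ioo_subset_Icc_self hx.1
  · exact Set.Ioo_subset_Icc_self hx.2

/-- A continuous function that is holomorphic off the real axis is holomorphic: by Morera's
theorem, since a rectangle that the real axis cuts is the union of two that it does not. -/
theorem differentiableOn_of_differentiableAt_of_im_ne_zero [CompleteSpace E] {f : ℂ → E}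
    {U : Set ℂ} (hU : IsOpen U) (hf : ContinuousOn f U)
    (hd : ∀ z ∈ U, z.im ≠ 0 → DifferentiableAt ℂ f z) : DifferentiableOn ℂ f U := by
  refine (isConservativeOn_and_continuousOn_iff_isDifferentiableOn hU).1 ⟨?_, hf⟩
  intro z w hzw
  rw [← add_eq_zero_iff_eq_neg, wedgeIntegral_add_wedgeIntegral_eq]
  by_cases h0 : (0 : ℝ) ∈ Set.Ioo (min z.im w.im) (max z.im w.im)
  · have h0' : (0 : ℝ) ∈ Set.uIcc z.im w.im := Set.Ioo_subset_Icc_self h0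
    have h1 : Rectangle z (w.re : ℂ) ⊆ U := fun x hx => hzw
      ⟨by simpa using hx.1, Set.uIcc_subset_uIcc Set.left_mem_uIcc h0' (by simpa using hx.2)⟩
    have h2 : Rectangle (z.re : ℂ) w ⊆ U := fun x hx => hzw
      ⟨by simpa using hx.1, Set.uIcc_subset_uIcc h0' Set.right_mem_uIcc (by simpa using hx.2)⟩
    have e1 := integral_boundary_rect_eq_zero_of_im_ne_zero hf hd h1 (by
      rintro y ⟨hy1, hy2⟩ rfl
      simp only [ofReal_im, min_lt_iff, lt_max_iff, lt_irrefl, or_false] at hy1 hy2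
      exact lt_asymm hy1 hy2)
    have e2 := integral_boundary_rect_eq_zero_of_im_ne_zero hf hd h2 (by
      rintro y ⟨hy1, hy2⟩ rfl
      simp only [ofReal_im, min_lt_iff, lt_max_iff, lt_irrefl, false_or] at hy1 hy2
      exact lt_asymm hy1 hy2)
    simp only [ofReal_re, ofReal_im, ofReal_zero, zero_mul, add_zero] at e1 e2
    have hv : ∀ a ∈ Set.uIcc z.re w.re, ∀ p ∈ Set.uIcc z.im w.im, ∀ q ∈ Set.uIcc z.im w.im,
        IntervalIntegrable (fun y : ℝ => f (a + y * I)) MeasureTheory.volume p q := by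
      intro a ha p hp q hq
      refine ContinuousOn.intervalIntegrable (hf.comp (by fun_prop) ?_)
      intro y hy
      exact hzw ⟨by simpa using ha, by simpa using Set.uIcc_subset_uIcc hp hq hy⟩
    have s1 := intervalIntegral.integral_add_adjacent_intervals
      (hv w.re Set.right_mem_uIcc z.im Set.left_mem_uIcc 0 h0')
      (hv w.re Set.right_mem_uIcc 0 h0' w.im Set.right_mem_uIcc)
    have s2 := intervalIntegral.integral_add_adjacent_intervals
      (hv z.re Set.left_mem_uIcc z.im Set.left_mem_uIcc 0 h0')
      (hv z.re Set.left_mem_uIcc 0 h0' w.im Set.right_mem_uIcc)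
    rw [← s1, ← s2]
    have := congrArg₂ (· + ·) e1 e2
    simp only [add_zero] at this
    rw [← this]
    simp only [smul_add]
    abel
  · exact integral_boundary_rect_eq_zero_of_im_ne_zero hf hd hzw fun y hy hy0 => h0 (hy0 ▸ hy)

/-- Two functions that are continuous on the two closed half planes, holomorphic inside and equal
on the real axis, are parts of one holomorphic function. -/
theorem differentiableOn_ite_im_le_zero [CompleteSpace E] {f g : ℂ → E} {U : Set ℂ}
    (hU : IsOpen U)
    (hf : ContinuousOn f (U ∩ {z | z.im ≤ 0})) (hg : ContinuousOn g (U ∩ {z | 0 ≤ z.im}))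
    (hf' : DifferentiableOn ℂ f (U ∩ {z | z.im < 0}))
    (hg' : DifferentiableOn ℂ g (U ∩ {z | 0 < z.im}))
    (hfg : ∀ z ∈ U, z.im = 0 → f z = g z) :
    DifferentiableOn ℂ (fun z => if z.im ≤ 0 then f z else g z) U := by
  refine differentiableOn_of_differentiableAt_of_im_ne_zero hU ?_ ?_
  · refine ContinuousOn.if (fun z hz => hfg z hz.1 ?_) (hf.mono ?_) (hg.mono ?_)
    · have := hz.2
      rw [frontier_setOfPred_im_le] at this
      exact this
    · rintro z ⟨hz, hz'⟩
      exact ⟨hz, by rwa [IsClosed.closure_eq (isClosed_le continuous_im continuous_const)] at hz'⟩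
    · rintro z ⟨hz, hz'⟩
      refine ⟨hz, ?_⟩
      simp only [not_le] at hz'
      rwa [closure_setOfPred_lt_im] at hz'
  · intro z hz hz0
    rcases lt_or_gt_of_ne hz0 with h | h
    · have hV : IsOpen (U ∩ {z : ℂ | z.im < 0}) :=
        hU.inter (isOpen_lt continuous_im continuous_const)
      refine (hf'.differentiableAt (hV.mem_nhds ⟨hz, h⟩)).congr_of_eventuallyEq ?_
      filter_upwards [hV.mem_nhds ⟨hz, h⟩] with x hx
      exact if_pos (le_of_lt hx.2)
    · have hV : IsOpen (U ∩ {z : ℂ | 0 < z.im}) :=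
        hU.inter (isOpen_lt continuous_const continuous_im)
      refine (hg'.differentiableAt (hV.mem_nhds ⟨hz, h⟩)).congr_of_eventuallyEq ?_
      filter_upwards [hV.mem_nhds ⟨hz, h⟩] with x hx
      exact if_neg (not_le.2 hx.2)

/-- A function on the closed lower half plane that is holomorphic inside and vanishes on an
interval of the boundary vanishes on the whole boundary. -/
theorem eq_zero_of_eqOn_Ioo [CompleteSpace E] {f : ℂ → E}
    (hf : ContinuousOn f {z | z.im ≤ 0}) (hf' : DifferentiableOn ℂ f {z | z.im < 0})
    {a b : ℝ} (hab : a < b) (h0 : ∀ t ∈ Set.Ioo a b, f (t : ℝ) = 0) (t : ℝ) : f t = 0 := by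
  set c : ℝ := (a + b) / 2 with hc
  set r : ℝ := (b - a) / 2 with hr
  have hr0 : 0 < r := by rw [hr]; linarith
  set U : Set ℂ := {z | z.im < 0} ∪ Metric.ball (c : ℂ) r
  have hlow : IsOpen {z : ℂ | z.im < 0} := isOpen_lt continuous_im continuous_const
  have hU : IsOpen U := hlow.union Metric.isOpen_ball
  have hmem : ∀ s : ℝ, 0 < s → s < r → (c : ℂ) + (s : ℝ) * I ∈ Metric.ball (c : ℂ) r ∧
      (c : ℂ) - (s : ℝ) * I ∈ Metric.ball (c : ℂ) r := by
    intro s hs hsr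
    constructor <;> simp [abs_of_pos hs, hsr, dist_eq_norm]
  have hconn : IsPreconnected U := by
    refine IsPreconnected.union ((c : ℂ) - ((r / 2 : ℝ) : ℂ) * I) ?_
      (hmem (r / 2) (by linarith) (by linarith)).2
      (convex_halfSpace_im_lt 0).isPreconnected (convex_ball _ _).isPreconnected
    simp
    linarith
  have hD : DifferentiableOn ℂ (fun z => if z.im ≤ 0 then f z else 0) U := by
    refine differentiableOn_ite_im_le_zero hU (hf.mono Set.inter_subset_right)
      continuousOn_const (hf'.mono Set.inter_subset_right) (differentiableOn_const _) ?_
    rintro z (hz | hz) hz0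
    · exact absurd hz0 (ne_of_lt hz)
    · have hzr : z = (z.re : ℂ) := Complex.ext rfl (by simp [hz0])
      rw [hzr, Metric.mem_ball, Complex.dist_eq, ← ofReal_sub, norm_real, Real.norm_eq_abs,
        abs_lt] at hz
      rw [hzr]
      exact h0 _ ⟨by linarith [hz.1], by linarith [hz.2]⟩
  have hz : Set.EqOn (fun z => if z.im ≤ 0 then f z else 0) 0 U := by
    refine (hD.analyticOnNhd hU).eqOn_zero_of_preconnected_of_eventuallyEq_zero hconn
      (z₀ := (c : ℂ) + ((r / 2 : ℝ) : ℂ) * I)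
      (Or.inr (hmem (r / 2) (by linarith) (by linarith)).1) ?_
    have hup : IsOpen {z : ℂ | 0 < z.im} := isOpen_lt continuous_const continuous_im
    filter_upwards [hup.mem_nhds (by simp; linarith :
      (c : ℂ) + ((r / 2 : ℝ) : ℂ) * I ∈ {z : ℂ | 0 < z.im})] with x hx
    exact if_neg (not_le.2 hx)
  have hcl : (t : ℂ) ∈ closure {z : ℂ | z.im < 0} := by
    rw [closure_setOfPred_im_lt]
    simp
  have hE : Set.EqOn f 0 (closure {z : ℂ | z.im < 0}) := by
    refine Set.EqOn.of_subset_closure (s := {z : ℂ | z.im < 0}) (t := closure {z : ℂ | z.im < 0})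
      ?_ ?_ continuousOn_const subset_closure subset_rfl
    · intro z hz'
      have hz0 : z.im < 0 := hz'
      have := hz (Or.inl hz')
      simpa only [if_pos hz0.le] using this
    · rwa [closure_setOfPred_im_lt]
  exact hE hcl

end Gluing

/-! ### Bounds from many zeros -/

lemma exists_eq_prod_mul_of_zeros {U : Set ℂ} (hU : IsOpen U) (s : Finset ℂ) :
    ∀ f : ℂ → ℂ, DifferentiableOn ℂ f U → (∀ y ∈ s, y ∈ U ∧ f y = 0) →
      ∃ g : ℂ → ℂ, DifferentiableOn ℂ g U ∧ ∀ z, f z = (∏ y ∈ s, (z - y)) * g z := by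
  classical
  induction s using Finset.induction_on with
  | empty => exact fun f hf _ => ⟨f, hf, by simp⟩
  | insert a s ha ih =>
    intro f hf h0
    obtain ⟨haU, ha0⟩ := h0 a (Finset.mem_insert_self a s)
    have hfa : ∀ z, f z = (z - a) * dslope f a z := fun z => by
      have := sub_smul_dslope f a z
      rw [ha0, sub_zero, smul_eq_mul] at this
      exact this.symm
    obtain ⟨g, hg, hg'⟩ := ih (dslope f a)
      ((differentiableOn_dslope (hU.mem_nhds haU)).2 hf) (by
        intro y hy
        obtain ⟨hyU, hy0⟩ := h0 y (Finset.mem_insert_of_mem hy)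
        refine ⟨hyU, ?_⟩
        have hya : y - a ≠ 0 := sub_ne_zero.2 (fun h => ha (h ▸ hy))
        have := hfa y
        rw [hy0] at this
        exact (mul_eq_zero.1 this.symm).resolve_left hya)
    refine ⟨g, hg, fun z => ?_⟩
    rw [Finset.prod_insert ha, hfa z, hg' z, mul_assoc]

/-- A Schwarz lemma for a function with many zeros near the centre of the disc. -/
lemma norm_le_of_zeros {f : ℂ → ℂ} {r ρ η M : ℝ} (hf : DifferentiableOn ℂ f (Metric.ball 0 r))
    (hM : ∀ z ∈ Metric.ball (0 : ℂ) r, ‖f z‖ ≤ M) (hη : η < ρ) (hη0 : 0 ≤ η) (hρ : ρ < r)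
    (s : Finset ℂ) (hs : ∀ y ∈ s, ‖y‖ ≤ η ∧ f y = 0) {z : ℂ} (hz : ‖z‖ ≤ ρ) :
    ‖f z‖ ≤ M * ((‖z‖ + η) / (ρ - η)) ^ s.card := by
  have hball : ∀ w : ℂ, ‖w‖ ≤ ρ → w ∈ Metric.ball (0 : ℂ) r := fun w hw => by
    rw [mem_ball_zero_iff]; linarith
  obtain ⟨g, hg, hfg⟩ := exists_eq_prod_mul_of_zeros Metric.isOpen_ball s f hf
    (fun y hy => ⟨hball y (by linarith [(hs y hy).1]), (hs y hy).2⟩)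
  have hρη : 0 < ρ - η := by linarith
  have hρ0 : ρ ≠ 0 := by linarith
  have hg1 : ∀ w ∈ frontier (Metric.ball (0 : ℂ) ρ), ‖g w‖ ≤ M / (ρ - η) ^ s.card := by
    intro w hw
    rw [frontier_ball _ hρ0, mem_sphere_zero_iff_norm] at hw
    rw [le_div_iff₀ (by positivity)]
    calc ‖g w‖ * (ρ - η) ^ s.card ≤ ‖g w‖ * ‖∏ y ∈ s, (w - y)‖ := by
          gcongr
          rw [norm_prod, ← Finset.prod_const]
          refine Finset.prod_le_prod (fun _ _ => hρη.le) (fun y hy => ?_)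
          have := norm_sub_norm_le w y
          linarith [(hs y hy).1]
      _ = ‖f w‖ := by rw [hfg w, norm_mul, mul_comm]
      _ ≤ M := hM w (hball w hw.le)
  have hg2 : ‖g z‖ ≤ M / (ρ - η) ^ s.card := by
    refine norm_le_of_forall_mem_frontier_norm_le Metric.isBounded_ball ?_ hg1 ?_
    · refine DifferentiableOn.diffContOnCl (hg.mono ?_)
      rw [closure_ball _ hρ0]
      exact Metric.closedBall_subset_ball hρ
    · rw [closure_ball _ hρ0]
      simpa using hz
  rw [hfg z, norm_mul, div_pow, ← mul_div_assoc, mul_comm M, mul_div_assoc]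
  gcongr
  rw [norm_prod, ← Finset.prod_const]
  refine Finset.prod_le_prod (fun _ _ => norm_nonneg _) (fun y hy => ?_)
  exact (norm_sub_le z y).trans (by linarith [(hs y hy).1])

/-- A number `w` vanishes if it is a limit of values at `z` of holomorphic functions on a fixed
disc, uniformly bounded there, with any number of zeros arbitrarily close to the centre. -/
lemma eq_zero_of_approx_zeros {r M : ℝ} {z w : ℂ} (hr : 0 < r) (hz : ‖z‖ < r / 2)
    (H : ∀ (n : ℕ) (η : ℝ), 0 < η → ∃ (f : ℂ → ℂ) (s : Finset ℂ),
      DifferentiableOn ℂ f (Metric.ball 0 r) ∧ (∀ z ∈ Metric.ball (0 : ℂ) r, ‖f z‖ ≤ M) ∧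
      s.card = n ∧ (∀ y ∈ s, ‖y‖ ≤ η ∧ f y = 0) ∧ ‖f z - w‖ ≤ η) : w = 0 := by
  set ρ : ℝ := 3 * r / 4
  have hρ0 : 0 < ρ := by simp only [ρ]; positivity
  have hq : ∀ n : ℕ, ‖w‖ ≤ M * (‖z‖ / ρ) ^ n := by
    intro n
    have hlim : Filter.Tendsto (fun η : ℝ => η + M * ((‖z‖ + η) / (ρ - η)) ^ n)
        (nhdsWithin 0 (Set.Ioi 0)) (nhds (0 + M * ((‖z‖ + 0) / (ρ - 0)) ^ n)) := by
      refine Filter.Tendsto.mono_left ?_ nhdsWithin_le_nhds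
      have : ContinuousAt (fun η : ℝ => η + M * ((‖z‖ + η) / (ρ - η)) ^ n) 0 := by
        have : ρ - 0 ≠ 0 := by rw [sub_zero]; exact hρ0.ne'
        fun_prop (disch := assumption)
      exact this
    simp only [zero_add, add_zero, sub_zero] at hlim
    refine ge_of_tendsto hlim ?_
    have : Set.Ioo (0 : ℝ) ρ ∈ nhdsWithin (0 : ℝ) (Set.Ioi 0) :=
      Ioo_mem_nhdsGT hρ0
    filter_upwards [this] with η hη
    obtain ⟨f, s, hf, hM, hs, h0, hw⟩ := H n η hη.1
    have := norm_le_of_zeros hf hM hη.2 hη.1.le (by simp only [ρ]; linarith) s h0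
      (z := z) (by simp only [ρ]; linarith)
    rw [hs] at this
    have h3 := norm_sub_norm_le w (f z)
    rw [norm_sub_rev] at h3
    linarith
  have hlt : ‖z‖ / ρ < 1 := by
    rw [div_lt_one hρ0]
    simp only [ρ]; linarith
  have hlim := (tendsto_pow_atTop_nhds_zero_of_lt_one
    (by positivity : 0 ≤ ‖z‖ / ρ) hlt).const_mul M
  rw [mul_zero] at hlim
  exact norm_le_zero_iff.1 (ge_of_tendsto' hlim hq)

end Complex

/-! ### Holomorphic extension of a unitary group with positive generator -/

section HolomorphicExtension

/-- The function `x ↦ exp (-i z / x)`, with its limit value `0` at `x = 0`. It is meant for `x ≥ 0`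
and `z` in the lower half plane: if `R` is the inverse of a positive operator `K`, then it maps `R`
to `exp (-i z K)`. -/
noncomputable def expInv (z x : ℂ) : ℂ :=
  if x = 0 then 0 else Complex.exp (-Complex.I * z / x)

lemma expInv_ofReal_norm (z : ℂ) {x : ℝ} (hx : 0 < x) :
    ‖expInv z x‖ = Real.exp (z.im * x⁻¹) := by
  have hx' : (x : ℂ) ≠ 0 := by exact_mod_cast hx.ne'
  rw [expInv, if_neg hx', Complex.norm_exp]
  congr 1
  rw [div_eq_mul_inv, ← Complex.ofReal_inv, Complex.re_mul_ofReal]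
  simp

lemma norm_inv_pow_mul_expInv_le {z : ℂ} (hz : z.im < 0) (k : ℕ) {x : ℝ} (hx : 0 ≤ x) :
    ‖(x : ℂ)⁻¹ ^ k * expInv z x‖ ≤ k.factorial / (-z.im) ^ k := by
  rcases hx.eq_or_lt with rfl | hx
  · have : 0 ≤ -z.im := by linarith
    simp only [expInv, Complex.ofReal_zero, if_true, mul_zero, norm_zero]
    positivity
  · have hb : 0 < -z.im := by linarith
    rw [norm_mul, expInv_ofReal_norm z hx, norm_pow, norm_inv, Complex.norm_real,
      Real.norm_of_nonneg hx.le, le_div_iff₀ (by positivity)]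
    have h := Real.pow_div_factorial_le_exp (-z.im * x⁻¹) (by positivity) k
    rw [div_le_iff₀ (by positivity)] at h
    calc x⁻¹ ^ k * Real.exp (z.im * x⁻¹) * (-z.im) ^ k
        = (-z.im * x⁻¹) ^ k * Real.exp (z.im * x⁻¹) := by rw [mul_pow]; ring
      _ ≤ Real.exp (-z.im * x⁻¹) * k.factorial * Real.exp (z.im * x⁻¹) := by gcongr
      _ = k.factorial * Real.exp (-z.im * x⁻¹ + z.im * x⁻¹) := by rw [Real.exp_add]; ring
      _ = k.factorial := by simp

lemma norm_expInv_le {z : ℂ} (hz : z.im < 0) {x : ℝ} (hx : 0 ≤ x) : ‖expInv z x‖ ≤ 1 := by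
  simpa using norm_inv_pow_mul_expInv_le hz 0 hx

/-- A function that is continuous away from `0` and of order `x` at `0` is continuous. -/
lemma continuousOn_of_norm_le_mul {f : ℂ → ℂ} {σ : Set ℂ} {C : ℝ}
    (hf : ∀ x : ℂ, x ≠ 0 → ContinuousAt f x) (h0 : f 0 = 0)
    (hC : ∀ x ∈ σ, ‖f x‖ ≤ C * ‖x‖) : ContinuousOn f σ := by
  intro x hx
  by_cases hx0 : x = 0
  · subst hx0
    rw [ContinuousWithinAt, h0]
    have : Filter.Tendsto (fun x : ℂ => C * ‖x‖) (nhdsWithin 0 σ) (nhds (C * ‖(0 : ℂ)‖)) :=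
      (Continuous.tendsto (by fun_prop) _).mono_left nhdsWithin_le_nhds
    rw [norm_zero, mul_zero] at this
    refine squeeze_zero_norm' ?_ this
    filter_upwards [self_mem_nhdsWithin] with y hy using hC y hy
  · exact (hf x hx0).continuousWithinAt

lemma continuousAt_expInv (z : ℂ) {x : ℂ} (hx : x ≠ 0) : ContinuousAt (expInv z) x := by
  have : ContinuousAt (fun x : ℂ => Complex.exp (-Complex.I * z / x)) x := by
    fun_prop (disch := assumption)
  refine this.congr ?_
  filter_upwards [isOpen_ne.mem_nhds hx] with y hy
  rw [expInv, if_neg hy]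

lemma continuousOn_inv_pow_mul_expInv {z : ℂ} (hz : z.im < 0) (k : ℕ) {σ : Set ℂ}
    (hσ : ∀ x ∈ σ, ∃ r : ℝ, 0 ≤ r ∧ x = r) :
    ContinuousOn (fun x : ℂ => x⁻¹ ^ k * expInv z x) σ := by
  refine continuousOn_of_norm_le_mul (C := (k + 1).factorial / (-z.im) ^ (k + 1))
    (fun x hx => ?_) (by simp [expInv]) ?_
  · exact ((continuousAt_inv₀ hx).pow k).mul (continuousAt_expInv z hx)
  · intro x hx
    obtain ⟨r, hr, rfl⟩ := hσ x hx
    rcases hr.eq_or_lt with rfl | hr0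
    · simp [expInv]
    · refine le_trans (le_of_eq ?_)
        (mul_le_mul_of_nonneg_right (norm_inv_pow_mul_expInv_le hz (k + 1) hr) (norm_nonneg _))
      have : (r : ℂ) ≠ 0 := by exact_mod_cast hr0.ne'
      rw [← norm_mul]
      congr 1
      rw [pow_succ]
      field_simp

lemma continuousOn_expInv {z : ℂ} (hz : z.im < 0) {σ : Set ℂ}
    (hσ : ∀ x ∈ σ, ∃ r : ℝ, 0 ≤ r ∧ x = r) : ContinuousOn (expInv z) σ := by
  simpa using continuousOn_inv_pow_mul_expInv hz 0 hσ

/-- Second-order Taylor estimate for `z ↦ exp (-i z / x)`, uniform in `x ≥ 0`. -/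
lemma norm_expInv_add_sub_le {z h : ℂ} (hz : z.im < 0) (hh : ‖h‖ ≤ -z.im / 2) {x : ℝ}
    (hx : 0 ≤ x) :
    ‖expInv (z + h) x - expInv z x - h * (-Complex.I * ((x : ℂ)⁻¹ ^ 1 * expInv z x))‖
      ≤ 8 / z.im ^ 2 * ‖h‖ ^ 2 := by
  rcases hx.eq_or_lt with rfl | hx
  · simp only [expInv, Complex.ofReal_zero, if_true, mul_zero, norm_zero, sub_zero]
    positivity
  have hx' : (x : ℂ) ≠ 0 := by exact_mod_cast hx.ne'
  set w : ℂ := -Complex.I * h / x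
  have hw : ‖w‖ = ‖h‖ * x⁻¹ := by
    simp [w, div_eq_mul_inv, abs_of_pos hx]
  have e1 : expInv (z + h) x - expInv z x - h * (-Complex.I * ((x : ℂ)⁻¹ ^ 1 * expInv z x))
      = expInv z x * (Complex.exp w - ∑ m ∈ Finset.range 2, w ^ m / (m.factorial : ℂ)) := by
    have : expInv (z + h) x = expInv z x * Complex.exp w := by
      rw [expInv, expInv, if_neg hx', if_neg hx', ← Complex.exp_add]
      congr 1
      simp only [w]; ring
    rw [this]
    simp only [Finset.sum_range_succ, Finset.range_zero, Finset.sum_empty, w]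
    simp
    ring
  -- half of the decay of `expInv z` absorbs the growth of `exp ‖w‖`, the other half the power
  have hz2 : ((z.im / 2 : ℝ) * Complex.I).im < 0 := by
    simp; linarith
  have hdec := norm_inv_pow_mul_expInv_le hz2 2 hx.le
  rw [norm_mul, expInv_ofReal_norm _ hx, norm_pow, norm_inv, Complex.norm_real,
    Real.norm_of_nonneg hx.le] at hdec
  rw [e1, norm_mul, expInv_ofReal_norm z hx]
  calc Real.exp (z.im * x⁻¹) * ‖Complex.exp w - ∑ m ∈ Finset.range 2, w ^ m / (m.factorial : ℂ)‖
      ≤ Real.exp (z.im * x⁻¹) * (‖w‖ ^ 2 * Real.exp ‖w‖) := by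
        gcongr
        exact Complex.norm_exp_sub_sum_le_norm_mul_exp w 2
    _ ≤ Real.exp (z.im * x⁻¹) * (‖w‖ ^ 2 * Real.exp (-z.im / 2 * x⁻¹)) := by
        gcongr
        rw [hw]
        gcongr
    _ = ‖h‖ ^ 2 * (x⁻¹ ^ 2 * Real.exp (z.im * x⁻¹ + -z.im / 2 * x⁻¹)) := by
        rw [Real.exp_add, hw]; ring
    _ ≤ ‖h‖ ^ 2 * (8 / z.im ^ 2) := by
        gcongr
        have hz0 : z.im ≠ 0 := hz.ne
        rw [Complex.im_ofReal_mul, Complex.I_im, Nat.factorial_two] at hdec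
        refine le_of_eq_of_le ?_ (hdec.trans_eq ?_)
        · congr 2
          ring
        · push_cast
          field_simp
          norm_num
    _ = 8 / z.im ^ 2 * ‖h‖ ^ 2 := mul_comm _ _

variable {H : Type*} [NormedAddCommGroup H] [InnerProductSpace ℂ H]

/-- `W t = exp (-i t K)` is a strongly continuous unitary group with a generator `K > 0` whose
inverse `R` is bounded. The relation between `W` and `R` is stated in integrated form, as
`(d/dt) W t R = -i W t`. -/
structure IsPositiveGroup [CompleteSpace H] (W : ℝ → H →L[ℂ] H) (R : H →L[ℂ] H) : Prop where
  zero : W 0 = 1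
  add : ∀ s t, W (s + t) = W s * W t
  norm_apply : ∀ t ψ, ‖W t ψ‖ = ‖ψ‖
  cont : ∀ ψ, Continuous fun t => W t ψ
  inv_nonneg : 0 ≤ R
  inv_injective : ∀ ψ, R ψ = 0 → ψ = 0
  comm : ∀ t, Commute (W t) R
  deriv : ∀ ψ t, HasDerivAt (fun t => W t (R ψ)) (-Complex.I • W t ψ) t

namespace IsPositiveGroup

variable [CompleteSpace H] {W : ℝ → H →L[ℂ] H} {R : H →L[ℂ] H}

lemma spectrum_nonneg (hW : IsPositiveGroup W R) :
    ∀ x ∈ spectrum ℂ R, ∃ r : ℝ, 0 ≤ r ∧ x = r := by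
  open scoped ComplexOrder in
  intro x hx
  have h : 0 ≤ x := spectrum_nonneg_of_nonneg hW.inv_nonneg hx
  rw [Complex.nonneg_iff] at h
  exact ⟨x.re, h.1, Complex.ext rfl (by simp [h.2])⟩

lemma isSelfAdjoint_inv (hW : IsPositiveGroup W R) : IsSelfAdjoint R :=
  IsSelfAdjoint.of_nonneg hW.inv_nonneg

lemma isStarNormal_inv (hW : IsPositiveGroup W R) : IsStarNormal R :=
  hW.isSelfAdjoint_inv.isStarNormal

lemma inner_inv_left (hW : IsPositiveGroup W R) (φ ψ : H) :
    inner ℂ (R φ) ψ = inner ℂ φ (R ψ) :=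
  (ContinuousLinearMap.isSelfAdjoint_iff_isSymmetric.1 hW.isSelfAdjoint_inv) φ ψ

/-- Uniqueness for the Schrödinger equation `y' = -i K y`, stated for `R y = K⁻¹ y`. -/
lemma eq_apply_of_hasDerivAt (hW : IsPositiveGroup W R) {y : ℝ → H}
    (hy : ∀ t, HasDerivAt (fun t => R (y t)) (-Complex.I • y t) t) (t : ℝ) :
    y t = W t (y 0) := by
  set D : ℝ → H := fun t => R (y t) - W t (R (y 0))
  have hD : ∀ t, HasDerivAt D (-Complex.I • (y t - W t (y 0))) t := fun t => by
    rw [smul_sub]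
    exact (hy t).sub (hW.deriv (y 0) t)
  have hDR : ∀ t, D t = R (y t - W t (y 0)) := fun t => by
    have := DFunLike.congr_fun (hW.comm t) (y 0)
    simp only [mul_apply_eq_comp] at this
    simp only [D, map_sub, this]
  have hN : ∀ t, HasDerivAt (fun t => inner ℂ (D t) (D t)) 0 t := fun t => by
    refine ((hD t).inner ℂ (hD t)).congr_deriv ?_
    rw [hDR, inner_smul_left, inner_smul_right, hW.inner_inv_left]
    simp only [map_neg, Complex.conj_I]
    ring
  have hc := is_const_of_deriv_eq_zero (fun t => (hN t).differentiableAt)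
    (fun t => (hN t).deriv) t 0
  have h0 : D 0 = 0 := by simp [D, hW.zero]
  have : D t = 0 := by
    simp only [h0, inner_zero_left] at hc
    exact inner_self_eq_zero.1 hc
  rw [hDR] at this
  exact sub_eq_zero.1 (hW.inv_injective _ this)

lemma hasDerivAt_cfc (hW : IsPositiveGroup W R) {z : ℂ} (hz : z.im < 0) :
    HasDerivAt (fun z => cfc (expInv z) R)
      (cfc (fun x : ℂ => -Complex.I * (x⁻¹ ^ 1 * expInv z x)) R) z := by
  have hR := hW.isStarNormal_inv
  have hσ := hW.spectrum_nonneg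
  rw [hasDerivAt_iff_isLittleO_nhds_zero]
  refine Asymptotics.IsBigO.trans_isLittleO (g := fun h : ℂ => ‖h‖ ^ 2) ?_ ?_
  · refine Asymptotics.IsBigO.of_bound (8 / z.im ^ 2) ?_
    have : Metric.closedBall (0 : ℂ) (-z.im / 2) ∈ nhds (0 : ℂ) :=
      Metric.closedBall_mem_nhds _ (by linarith)
    filter_upwards [this] with h hh
    rw [mem_closedBall_zero_iff] at hh
    have hzh : (z + h).im < 0 := by
      have := (Complex.abs_im_le_norm h).trans hh
      rw [Complex.add_im]
      linarith [le_abs_self h.im]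
    have c1 := continuousOn_expInv hzh hσ
    have c2 := continuousOn_expInv hz hσ
    have c3 : ContinuousOn (fun x : ℂ => -Complex.I * (x⁻¹ ^ 1 * expInv z x)) (spectrum ℂ R) :=
      continuousOn_const.mul (continuousOn_inv_pow_mul_expInv hz 1 hσ)
    rw [← cfc_smul h _ R c3, ← cfc_sub _ _ R c1 c2,
      ← cfc_sub (fun x => expInv (z + h) x - expInv z x)
        (fun x => h • (-Complex.I * (x⁻¹ ^ 1 * expInv z x))) R (c1.sub c2)
        (c3.const_smul h)]
    refine norm_cfc_le (by positivity) fun x hx => ?_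
    obtain ⟨r, hr, rfl⟩ := hσ x hx
    simpa using norm_expInv_add_sub_le hz hh hr
  · have := (Asymptotics.isLittleO_norm_pow_id (E' := ℂ) one_lt_two)
    exact this

lemma norm_cfc_expInv_le (hW : IsPositiveGroup W R) {z : ℂ} (hz : z.im < 0) :
    ‖cfc (expInv z) R‖ ≤ 1 :=
  norm_cfc_le zero_le_one fun x hx => by
    obtain ⟨r, hr, rfl⟩ := hW.spectrum_nonneg x hx
    exact norm_expInv_le hz hr

/-- Along horizontal lines, `exp (-i z K)` is the given group. -/
lemma cfc_expInv_add (hW : IsPositiveGroup W R) {z : ℂ} (hz : z.im < 0) (t : ℝ) :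
    cfc (expInv (z + t)) R = W t * cfc (expInv z) R := by
  have hR := hW.isStarNormal_inv
  have hσ := hW.spectrum_nonneg
  ext χ
  have key := hW.eq_apply_of_hasDerivAt (y := fun t : ℝ => cfc (expInv (z + t)) R χ) (fun t => ?_) t
  · simpa using key
  have hzt : (z + t).im < 0 := by simpa using hz
  have h1 := R.hasFDerivAt.comp_hasDerivAt _ ((hW.hasDerivAt_cfc hzt).clm_apply
    (hasDerivAt_const (z + t) χ))
  simp only [map_zero, add_zero] at h1
  have h2 := (h1.comp_const_add z (t : ℂ)).scomp t Complex.ofRealCLM.hasDerivAt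
  refine h2.congr_deriv ?_
  have h4 : R * cfc (fun x : ℂ => -Complex.I * (x⁻¹ ^ 1 * expInv (z + t) x)) R
      = -Complex.I • cfc (expInv (z + t)) R := by
    conv_lhs => enter [1]; rw [← cfc_id' ℂ R]
    rw [← cfc_mul (fun x : ℂ => x) (fun x : ℂ => -Complex.I * (x⁻¹ ^ 1 * expInv (z + t) x)) R
      continuousOn_id
      (continuousOn_const.mul (continuousOn_inv_pow_mul_expInv hzt 1 hσ)),
      ← cfc_smul _ _ R (continuousOn_expInv hzt hσ)]
    refine cfc_congr fun x _ => ?_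
    by_cases hx : x = 0
    · simp [hx, expInv]
    · simp only [pow_one, smul_eq_mul]
      field_simp
  have := DFunLike.congr_fun h4 χ
  rw [mul_apply_eq_comp] at this
  simpa using this

end IsPositiveGroup

end HolomorphicExtension

/-! ### Boundary values of the holomorphic extension -/

section HolomorphicExtensionProperties

variable {H : Type*} [NormedAddCommGroup H] [InnerProductSpace ℂ H]

lemma continuous_apply_of_norm_le_one {X : Type*} [TopologicalSpace X] {B : X → H →L[ℂ] H}
    (hB : ∀ x, ‖B x‖ ≤ 1) (hc : ∀ χ, Continuous fun x => B x χ) :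
    Continuous fun p : X × H => B p.1 p.2 := by
  rw [continuous_iff_continuousAt]
  rintro ⟨x₀, χ₀⟩
  have h1 : Filter.Tendsto (fun p : X × H => B p.1 (p.2 - χ₀)) (nhds (x₀, χ₀)) (nhds 0) := by
    have : Filter.Tendsto (fun p : X × H => ‖p.2 - χ₀‖) (nhds (x₀, χ₀)) (nhds 0) := by
      have : Continuous fun p : X × H => ‖p.2 - χ₀‖ := by fun_prop
      simpa using this.tendsto (x₀, χ₀)
    refine squeeze_zero_norm (fun p => ?_) this
    exact ((B p.1).le_of_opNorm_le (hB _) _).trans (by simp)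
  have h2 : Filter.Tendsto (fun p : X × H => B p.1 χ₀) (nhds (x₀, χ₀)) (nhds (B x₀ χ₀)) :=
    ((hc χ₀).comp continuous_fst).tendsto (x₀, χ₀)
  have := h1.add h2
  simp only [map_sub, sub_add_cancel, zero_add] at this
  exact this

variable [CompleteSpace H]

lemma IsSelfAdjoint.denseRange {T : H →L[ℂ] H} (hT : IsSelfAdjoint T)
    (hinj : ∀ ψ, T ψ = 0 → ψ = 0) : DenseRange T := by
  have h : (T : H →ₗ[ℂ] H).rangeᗮ = ⊥ := by
    rw [ContinuousLinearMap.orthogonal_range, ← ContinuousLinearMap.star_eq_adjoint, hT.star_eq]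
    exact LinearMap.ker_eq_bot'.2 hinj
  have := (Submodule.dense_iff_topologicalClosure_eq_top).2
    ((Submodule.topologicalClosure_eq_top_iff).2 h)
  rwa [LinearMap.coe_range] at this

/-- The contraction `exp (-β K)` for `β ≥ 0`, where `R = K⁻¹`; it is `1` for `β ≤ 0`. -/
noncomputable def decay (R : H →L[ℂ] H) (β : ℝ) : H →L[ℂ] H :=
  if β ≤ 0 then 1 else cfc (expInv (-(Complex.I * β))) R

/-- The operator `exp (-i z K)` for `z` in the closed lower half plane, where
`W t = exp (-i t K)` and `R = K⁻¹`. -/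
noncomputable def holoExt (W : ℝ → H →L[ℂ] H) (R : H →L[ℂ] H) (z : ℂ) : H →L[ℂ] H :=
  W z.re * decay R (-z.im)

namespace IsPositiveGroup

variable {W : ℝ → H →L[ℂ] H} {R : H →L[ℂ] H}

lemma norm_le_one (hW : IsPositiveGroup W R) (t : ℝ) : ‖W t‖ ≤ 1 :=
  ContinuousLinearMap.opNorm_le_bound _ zero_le_one fun ψ => by rw [hW.norm_apply, one_mul]

lemma norm_decay_le (hW : IsPositiveGroup W R) (β : ℝ) : ‖decay R β‖ ≤ 1 := by
  rw [decay]
  split_ifs with h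
  · exact ContinuousLinearMap.norm_id_le
  · exact hW.norm_cfc_expInv_le (by simpa using h)

lemma norm_holoExt_le (hW : IsPositiveGroup W R) (z : ℂ) : ‖holoExt W R z‖ ≤ 1 :=
  (norm_mul_le _ _).trans (mul_le_one₀ (hW.norm_le_one _) (norm_nonneg _) (hW.norm_decay_le _))

lemma commute_decay (hW : IsPositiveGroup W R) (t β : ℝ) : Commute (W t) (decay R β) := by
  rw [decay]
  split_ifs with h
  · exact Commute.one_right _
  · refine (Commute.cfc (hW.comm t).symm ?_ _).symm
    rw [hW.isSelfAdjoint_inv.star_eq]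
    exact (hW.comm t).symm

lemma holoExt_eq_cfc (hW : IsPositiveGroup W R) {z : ℂ} (hz : z.im < 0) :
    holoExt W R z = cfc (expInv z) R := by
  rw [holoExt, decay, if_neg (by simpa using hz), ← hW.cfc_expInv_add (by simpa using hz)]
  congr 2
  apply Complex.ext <;> simp

lemma differentiableAt_holoExt (hW : IsPositiveGroup W R) {z : ℂ} (hz : z.im < 0) :
    DifferentiableAt ℂ (holoExt W R) z := by
  refine (hW.hasDerivAt_cfc hz).differentiableAt.congr_of_eventuallyEq ?_
  filter_upwards [(isOpen_lt Complex.continuous_im continuous_const).mem_nhds hz] with w hw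
  exact hW.holoExt_eq_cfc hw

@[simp] lemma holoExt_ofReal (t : ℝ) : holoExt W R (t : ℂ) = W t := by
  simp [holoExt, decay]

lemma holoExt_of_im_eq (t β : ℝ) {z : ℂ} (hz : z = t - Complex.I * β) :
    holoExt W R z = W t * decay R β := by
  simp [hz, holoExt]

lemma continuousOn_mul_exp (hW : IsPositiveGroup W R) {β : ℝ} (hβ : 0 ≤ β) :
    ContinuousOn (fun x : ℂ => x * Complex.exp (-β / x)) (spectrum ℂ R) := by
  refine continuousOn_of_norm_le_mul (C := 1) (fun x hx => ?_) (by simp) ?_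
  · fun_prop (disch := assumption)
  · intro x hx
    obtain ⟨r, hr, rfl⟩ := hW.spectrum_nonneg x hx
    rw [norm_mul, ← Complex.ofReal_neg, ← Complex.ofReal_div, Complex.norm_exp,
      Complex.ofReal_re, mul_comm]
    gcongr
    rw [Real.exp_le_one_iff, neg_div]
    have := div_nonneg hβ hr
    linarith

lemma decay_mul_inv (hW : IsPositiveGroup W R) (β : ℝ) :
    decay R β * R = cfc (fun x : ℂ => x * Complex.exp (-(max β 0 : ℝ) / x)) R := by
  have hR := hW.isStarNormal_inv
  rw [decay]
  split_ifs with h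
  · rw [max_eq_right h, one_mul]
    simp only [Complex.ofReal_zero, neg_zero, zero_div, Complex.exp_zero, mul_one]
    exact (cfc_id' ℂ R).symm
  · rw [not_le] at h
    rw [max_eq_left h.le]
    conv_lhs => enter [2]; rw [← cfc_id' ℂ R]
    rw [← cfc_mul _ (fun x : ℂ => x) R
      (continuousOn_expInv (by simpa using h) hW.spectrum_nonneg) continuousOn_id]
    refine cfc_congr fun x _ => ?_
    by_cases hx : x = 0
    · simp [hx]
    · simp only [expInv, if_neg hx]
      rw [mul_comm]
      congr 3
      linear_combination (β : ℂ) * Complex.I_mul_I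

lemma norm_decay_inv_sub_le (hW : IsPositiveGroup W R) (β γ : ℝ) (η : H) :
    ‖decay R β (R η) - decay R γ (R η)‖ ≤ |β - γ| * ‖η‖ := by
  have hR := hW.isStarNormal_inv
  have key : ∀ {r a b : ℝ}, 0 < r → a ≤ b → 0 ≤ a →
      |r * Real.exp (-a / r) - r * Real.exp (-b / r)| ≤ |a - b| := by
    intro r a b hr hab ha
    have h1 : Real.exp (-b / r) = Real.exp (-a / r) * Real.exp (-((b - a) / r)) := by
      rw [← Real.exp_add]; congr 1; ring
    have h2 := Real.add_one_le_exp (-((b - a) / r))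
    have h3 : Real.exp (-a / r) ≤ 1 := by
      rw [Real.exp_le_one_iff, neg_div]
      have := div_nonneg ha hr.le
      linarith
    have h5 : Real.exp (-((b - a) / r)) ≤ 1 := by
      rw [Real.exp_le_one_iff]
      have := div_nonneg (sub_nonneg.2 hab) hr.le
      linarith
    rw [abs_sub_comm a b, abs_of_nonneg (sub_nonneg.2 hab), h1, ← mul_assoc, ← mul_one_sub,
      abs_of_nonneg (mul_nonneg (by positivity) (sub_nonneg.2 h5))]
    calc r * Real.exp (-a / r) * (1 - Real.exp (-((b - a) / r)))
        ≤ r * 1 * ((b - a) / r) := by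
          refine mul_le_mul (by gcongr) (by linarith) (by linarith) (by positivity)
      _ = b - a := by field_simp
  have h : ‖decay R β * R - decay R γ * R‖ ≤ |β - γ| := by
    have c1 := hW.continuousOn_mul_exp (le_max_right β 0)
    have c2 := hW.continuousOn_mul_exp (le_max_right γ 0)
    rw [hW.decay_mul_inv, hW.decay_mul_inv,
      ← cfc_sub (fun x : ℂ => x * Complex.exp (-(max β 0 : ℝ) / x))
        (fun x : ℂ => x * Complex.exp (-(max γ 0 : ℝ) / x)) R c1 c2]
    refine norm_cfc_le (abs_nonneg _) fun x hx => ?_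
    obtain ⟨r, hr, rfl⟩ := hW.spectrum_nonneg x hx
    rcases hr.eq_or_lt with rfl | hr0
    · simp
    · refine le_trans ?_ (abs_max_sub_max_le_abs β γ 0)
      have e : ∀ b : ℝ, (r : ℂ) * Complex.exp (-(b : ℝ) / r) = ((r * Real.exp (-b / r) : ℝ) : ℂ) :=
        fun b => by push_cast; rfl
      rw [e, e, ← Complex.ofReal_sub, Complex.norm_real, Real.norm_eq_abs]
      rcases le_total (max β 0) (max γ 0) with h | h
      · exact key hr0 h (le_max_right _ _)
      · rw [abs_sub_comm, abs_sub_comm (max β 0)]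
        exact key hr0 h (le_max_right _ _)
  exact (decay R β * R - decay R γ * R).le_of_opNorm_le h η

lemma continuous_decay (hW : IsPositiveGroup W R) (χ : H) : Continuous fun β => decay R β χ := by
  have hd := IsSelfAdjoint.denseRange hW.isSelfAdjoint_inv hW.inv_injective
  rw [Metric.continuous_iff]
  intro β ε hε
  obtain ⟨η, hη⟩ := hd.exists_dist_lt χ (by positivity : 0 < ε / 4)
  rw [dist_eq_norm] at hη
  refine ⟨ε / (4 * (‖η‖ + 1)), by positivity, fun γ hγ => ?_⟩
  rw [Real.dist_eq, lt_div_iff₀ (by positivity)] at hγ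
  have e : decay R γ χ - decay R β χ
      = decay R γ (χ - R η) + (decay R γ (R η) - decay R β (R η)) - decay R β (χ - R η) := by
    simp only [map_sub]; abel
  rw [dist_eq_norm, e]
  have h1 := (decay R γ).le_of_opNorm_le (hW.norm_decay_le γ) (χ - R η)
  have h2 := (decay R β).le_of_opNorm_le (hW.norm_decay_le β) (χ - R η)
  have h3 := hW.norm_decay_inv_sub_le γ β η
  have h4 : |γ - β| * ‖η‖ ≤ |γ - β| * (‖η‖ + 1) := by gcongr; linarith
  refine (norm_sub_le _ _).trans_lt ?_
  have := norm_add_le (decay R γ (χ - R η)) (decay R γ (R η) - decay R β (R η))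
  linarith

lemma continuous_apply (hW : IsPositiveGroup W R) : Continuous fun p : ℝ × H => W p.1 p.2 :=
  continuous_apply_of_norm_le_one hW.norm_le_one hW.cont

lemma continuous_holoExt_apply (hW : IsPositiveGroup W R) :
    Continuous fun p : ℂ × H => holoExt W R p.1 p.2 := by
  refine continuous_apply_of_norm_le_one hW.norm_holoExt_le fun χ => ?_
  exact hW.continuous_apply.comp (Complex.continuous_re.prodMk
    ((hW.continuous_decay χ).comp Complex.continuous_im.neg))

lemma isSelfAdjoint_decay (hW : IsPositiveGroup W R) (β : ℝ) : IsSelfAdjoint (decay R β) := by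
  have hR := hW.isStarNormal_inv
  rw [decay]
  split_ifs with h
  · exact IsSelfAdjoint.one _
  · rw [IsSelfAdjoint, ← cfc_star]
    refine cfc_congr fun x hx => ?_
    obtain ⟨r, hr, rfl⟩ := hW.spectrum_nonneg x hx
    by_cases hr0 : (r : ℂ) = 0
    · simp [expInv, hr0]
    · simp only [expInv, if_neg hr0]
      rw [Complex.star_def, ← Complex.exp_conj]
      congr 1
      simp

lemma decay_half_mul (hW : IsPositiveGroup W R) {β : ℝ} (hβ : 0 < β) :
    decay R (β / 2) * decay R (β / 2) = decay R β := by
  have hR := hW.isStarNormal_inv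
  have hc := continuousOn_expInv (z := -(Complex.I * ((β / 2 : ℝ) : ℂ)))
    (by simpa using hβ) hW.spectrum_nonneg
  rw [decay, decay, if_neg (by linarith), if_neg (by linarith), ← cfc_mul _ _ R hc hc]
  refine cfc_congr fun x _ => ?_
  by_cases hx : x = 0
  · simp [expInv, hx]
  · simp only [expInv, if_neg hx]
    rw [← Complex.exp_add]
    congr 1
    push_cast
    ring

lemma decay_injective (hW : IsPositiveGroup W R) {β : ℝ} (hβ : 0 < β) {ψ : H}
    (hψ : decay R β ψ = 0) : ψ = 0 := by
  have h : ∀ n : ℕ, decay R (β / 2 ^ n) ψ = 0 := by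
    intro n
    induction n with
    | zero => simpa using hψ
    | succ n ih =>
      have hs := ContinuousLinearMap.isSelfAdjoint_iff_isSymmetric.1
        (hW.isSelfAdjoint_decay (β / 2 ^ n / 2)) (decay R (β / 2 ^ n / 2) ψ) ψ
      have hm := DFunLike.congr_fun (hW.decay_half_mul (by positivity : 0 < β / 2 ^ n)) ψ
      rw [mul_apply_eq_comp, ih] at hm
      rw [pow_succ, ← div_div]
      rw [← inner_self_eq_zero (𝕜 := ℂ)]
      refine hs.symm.trans ?_
      change inner ℂ (decay R (β / 2 ^ n / 2) (decay R (β / 2 ^ n / 2) ψ)) ψ = 0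
      rw [hm, inner_zero_left]
  have hlim : Filter.Tendsto (fun n : ℕ => β / 2 ^ n) Filter.atTop (nhds 0) := by
    have := (tendsto_pow_atTop_nhds_zero_of_lt_one (by norm_num : (0 : ℝ) ≤ 1 / 2)
      (by norm_num)).const_mul β
    simpa [div_eq_mul_inv] using this
  have h2 := ((hW.continuous_decay ψ).tendsto 0).comp hlim
  simp only [Function.comp_def, h] at h2
  have h3 := tendsto_nhds_unique h2 tendsto_const_nhds
  simpa [decay] using h3

/-- If `X exp (-i t K) Y` vanishes on a time interval, then for all times. -/
lemma mul_mul_eq_zero (hW : IsPositiveGroup W R) {X Y : H →L[ℂ] H} {a b : ℝ} (hab : a < b)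
    (h : ∀ t ∈ Set.Ioo a b, X * W t * Y = 0) (t : ℝ) : X * W t * Y = 0 := by
  ext χ
  have := Complex.eq_zero_of_eqOn_Ioo (f := fun z => X (holoExt W R z (Y χ))) ?_ ?_ hab ?_ t
  · simpa using this
  · exact (X.continuous.comp (hW.continuous_holoExt_apply.comp
      (continuous_id.prodMk continuous_const))).continuousOn
  · intro z hz
    exact (X.differentiableAt.comp z ((hW.differentiableAt_holoExt hz).clm_apply
      (differentiableAt_const _))).differentiableWithinAt
  · intro s hs
    simpa using DFunLike.congr_fun (h s hs) χ

end IsPositiveGroup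

end HolomorphicExtensionProperties

/-! ### Borchers' lemma -/

section Borchers

variable {H : Type*} [NormedAddCommGroup H] [InnerProductSpace ℂ H] [CompleteSpace H]

namespace IsPositiveGroup

variable {W : ℝ → H →L[ℂ] H} {R : H →L[ℂ] H}

lemma apply_neg_mul (hW : IsPositiveGroup W R) (t : ℝ) : W (-t) * W t = 1 := by
  rw [← hW.add, neg_add_cancel, hW.zero]

lemma conj_mul_conj (hW : IsPositiveGroup W R) (t : ℝ) (X Y : H →L[ℂ] H) :
    (W t * X * W (-t)) * (W t * Y * W (-t)) = W t * (X * Y) * W (-t) := by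
  calc (W t * X * W (-t)) * (W t * Y * W (-t))
      = W t * X * (W (-t) * W t) * Y * W (-t) := by simp only [mul_assoc]
    _ = _ := by rw [hW.apply_neg_mul]; simp only [mul_assoc, mul_one]

lemma conj_conj (hW : IsPositiveGroup W R) (s t : ℝ) (X : H →L[ℂ] H) :
    W s * (W t * X * W (-t)) * W (-s) = W (s + t) * X * W (-(s + t)) := by
  rw [neg_add_rev, hW.add, hW.add]
  simp only [mul_assoc]

/-- If `e F = 0` and `e` commutes with the translates `F(t)` of `F` for small `t`, then for every
`n` a product `Q` of `n` translates `e(y)` of `e` has `n` different zeros `y`, in the sense that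
`Q F(y) = 0`; it commutes with `F(t)` for small `t`, and it is close to `e ^ n` at a given vector
if the times `y` are close to `0`. -/
lemma exists_prod_conj (hW : IsPositiveGroup W R) {e F : H →L[ℂ] H} {ε η : ℝ} (hη : 0 < η)
    (hηε : 2 * η ≤ ε) (he : ‖e‖ ≤ 1) (heF : e * F = 0)
    (hc : ∀ t, |t| < ε → Commute e (W t * F * W (-t))) (χ : H) (n : ℕ) :
    ∀ δ > 0, ∃ (s : Finset ℝ) (Q : H →L[ℂ] H), s.card = n ∧ (∀ y ∈ s, 0 < y ∧ y < η) ∧ ‖Q‖ ≤ 1 ∧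
      (∀ y ∈ s, Q * (W y * F * W (-y)) = 0) ∧
      (∀ t, |t| < ε - η → Commute Q (W t * F * W (-t))) ∧ ‖Q χ - (e ^ n) χ‖ < δ := by
  induction n with
  | zero =>
    intro δ hδ
    exact ⟨∅, 1, by simp, by simp, ContinuousLinearMap.norm_id_le, by simp,
      fun t _ => Commute.one_left _, by simpa using hδ⟩
  | succ n ih =>
    intro δ hδ
    obtain ⟨s, Q, hs, hsη, hQ, hQ0, hQc, hQχ⟩ := ih (δ / 2) (by positivity)
    have hcont : Continuous fun y : ℝ => W y (e (W (-y) (Q χ))) :=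
      hW.continuous_apply.comp (continuous_id.prodMk
        (e.continuous.comp (hW.continuous_apply.comp (continuous_neg.prodMk continuous_const))))
    have hlim : Filter.Tendsto (fun y : ℝ => ‖W y (e (W (-y) (Q χ))) - e (Q χ)‖)
        (nhdsWithin 0 (Set.Ioi 0)) (nhds 0) := by
      have := (hcont.sub continuous_const).norm.tendsto (0 : ℝ) (f := fun y : ℝ =>
        ‖W y (e (W (-y) (Q χ))) - e (Q χ)‖)
      simp only [neg_zero, hW.zero, one_apply_eq_self, sub_self, norm_zero] at this
      exact this.mono_left nhdsWithin_le_nhds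
    have hnot : ∀ᶠ y in nhdsWithin (0 : ℝ) (Set.Ioi 0), y ∉ s := by
      have h0 : (0 : ℝ) ∉ s := fun h => lt_irrefl _ (hsη 0 h).1
      exact nhdsWithin_le_nhds (s.finite_toSet.isClosed.isOpen_compl.mem_nhds (by simpa using h0))
    obtain ⟨y, hy1, hy2, hyη⟩ := ((hlim.eventually (gt_mem_nhds (by positivity : 0 < δ / 2))).and
      (hnot.and (Ioo_mem_nhdsGT hη))).exists
    set ey : H →L[ℂ] H := W y * e * W (-y)
    have hey : ‖ey‖ ≤ 1 := by
      refine (norm_mul_le _ _).trans (mul_le_one₀ ((norm_mul_le _ _).trans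
        (mul_le_one₀ (hW.norm_le_one _) (norm_nonneg _) he)) (norm_nonneg _) (hW.norm_le_one _))
    have heyF : ey * (W y * F * W (-y)) = 0 := by
      rw [hW.conj_mul_conj, heF, mul_zero, zero_mul]
    have heyc : ∀ t, |t| < ε - η → Commute ey (W t * F * W (-t)) := by
      intro t ht
      have h1 : W t * F * W (-t) = W y * (W (t - y) * F * W (-(t - y))) * W (-y) := by
        rw [hW.conj_conj, add_sub_cancel]
      have h2 : |t - y| < ε := by
        have := abs_sub t y
        rw [abs_of_pos hyη.1] at this
        linarith [hyη.2]
      rw [h1, Commute, SemiconjBy, hW.conj_mul_conj, hW.conj_mul_conj, (hc _ h2).eq]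
    refine ⟨insert y s, ey * Q, by rw [Finset.card_insert_of_notMem hy2, hs], ?_, ?_, ?_, ?_, ?_⟩
    · intro x hx
      rcases Finset.mem_insert.1 hx with rfl | hx
      · exact hyη
      · exact hsη x hx
    · exact (norm_mul_le _ _).trans (mul_le_one₀ hey (norm_nonneg _) hQ)
    · intro x hx
      rcases Finset.mem_insert.1 hx with rfl | hx
      · have : |x| < ε - η := by rw [abs_of_pos hyη.1]; linarith [hyη.2]
        rw [mul_assoc, (hQc x this).eq, ← mul_assoc, heyF, zero_mul]
      · rw [mul_assoc, hQ0 x hx, mul_zero]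
    · exact fun t ht => (heyc t ht).mul_left (hQc t ht)
    · have e1 : (ey * Q) χ - (e ^ (n + 1)) χ
          = (W y (e (W (-y) (Q χ))) - e (Q χ)) + e (Q χ - (e ^ n) χ) := by
        rw [pow_succ']
        simp [ey]
      rw [e1]
      refine (norm_add_le _ _).trans_lt ?_
      have := e.le_of_opNorm_le he (Q χ - (e ^ n) χ)
      linarith

/-- Borchers' lemma, for operators `e' = e' e` and `F` instead of projections: if `e F = 0`, and
`e`, `e'` commute with the translates of `F` for small times, then `e'` annihilates the translates
of `F` for all times.

The function `e' F(t)`, taken between vectors in the range of `exp (-K)`, extends holomorphically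
to both sides of the real axis near `0`, in one way as `e' F(t)` and in the other as `F(t) e'`.
So do the functions `e' Q F(t)` with the products `Q` of `exists_prod_conj`, which have many zeros
near `0`; since `e' Q` tends to `e'`, the function `e' F(t)` is of infinite order at `0`. -/
theorem mul_conj_eq_zero_of_commute (hW : IsPositiveGroup W R) {e e' F : H →L[ℂ] H} {ε : ℝ}
    (hε : 0 < ε) (he : ‖e‖ ≤ 1) (hee : e' * e = e') (heF : e * F = 0)
    (hc : ∀ t, |t| < ε → Commute e (W t * F * W (-t)))
    (hc' : ∀ t, |t| < ε → Commute e' (W t * F * W (-t))) (t : ℝ) :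
    e' * (W t * F * W (-t)) = 0 := by
  have heen : ∀ n : ℕ, e' * e ^ n = e' := by
    intro n
    induction n with
    | zero => simp
    | succ n ih => rw [pow_succ, ← mul_assoc, ih, hee]
  set r : ℝ := min 1 (ε / 2)
  have hr0 : 0 < r := by simp only [r]; positivity
  have hr1 : r ≤ 1 := min_le_left _ _
  have hrε : r ≤ ε / 2 := min_le_right _ _
  set S : H →L[ℂ] H := decay R 1
  have hSn : ∀ ψ, ‖S ψ‖ ≤ ‖ψ‖ := fun ψ => by
    simpa using S.le_of_opNorm_le (hW.norm_decay_le 1) ψ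
  have hTn : ∀ z ψ, ‖holoExt W R z ψ‖ ≤ ‖ψ‖ := fun z ψ => by
    simpa using (holoExt W R z).le_of_opNorm_le (hW.norm_holoExt_le z) ψ
  have small : ∀ t : ℝ, |t| < r / 2 → ∀ χ χ' : H,
      inner ℂ χ' (S (e' (W t (F (W (-t) (S χ)))))) = 0 := by
    intro t ht χ χ'
    refine Complex.eq_zero_of_approx_zeros (r := r) (M := ‖χ'‖ * (‖e'‖ * (‖F‖ * ‖χ‖))) (z := t)
      hr0 (by simpa using ht) fun n η₀ hη₀ => ?_
    set η : ℝ := min η₀ (ε / 2)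
    have hη : 0 < η := by simp only [η]; positivity
    set ψ : H := W t (F (W (-t) (S χ)))
    obtain ⟨s, Q, hs, hsη, hQ, hQ0, hQc, hQψ⟩ := hW.exists_prod_conj hη
      (by have := min_le_right η₀ (ε / 2); simp only [η]; linarith) he heF hc ψ n
      (η₀ / (‖χ'‖ * ‖e'‖ + 1)) (by positivity)
    have hQn : ∀ φ, ‖Q φ‖ ≤ ‖φ‖ := fun φ => by simpa using Q.le_of_opNorm_le hQ φ
    set f₁ : ℂ → ℂ := fun z => innerSL ℂ χ'
      (S (e' (Q (holoExt W R z (F (holoExt W R (-z - Complex.I) χ))))))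
    set f₂ : ℂ → ℂ := fun z => innerSL ℂ χ'
      (holoExt W R (z - Complex.I) (F (holoExt W R (-z) (e' (Q (S χ))))))
    have hT1 : ∀ t : ℝ, holoExt W R (-t - Complex.I) = W (-t) * S := fun t =>
      holoExt_of_im_eq (-t) 1 (by simp)
    have hT2 : ∀ t : ℝ, holoExt W R (t - Complex.I) = S * W t := fun t => by
      rw [holoExt_of_im_eq t 1 (by simp), (hW.commute_decay t 1).eq]
    have hT3 : ∀ t : ℝ, holoExt W R (-(t : ℂ)) = W (-t) := fun t => by
      rw [← Complex.ofReal_neg, holoExt_ofReal]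
    have hf₁ : ∀ t : ℝ, f₁ t = inner ℂ χ' (S (e' (Q (W t (F (W (-t) (S χ))))))) := fun t => by
      simp only [f₁, hT1, holoExt_ofReal, innerSL_apply_apply, mul_apply_eq_comp]
    have him : ∀ z ∈ Metric.ball (0 : ℂ) r, |z.im| < 1 := fun z hz => by
      rw [mem_ball_zero_iff] at hz
      exact (Complex.abs_im_le_norm z).trans_lt (hz.trans_le hr1)
    refine ⟨fun z => if z.im ≤ 0 then f₁ z else f₂ z, s.map ⟨_, Complex.ofReal_injective⟩,
      ?_, ?_, by rw [Finset.card_map, hs], ?_, ?_⟩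
    · refine Complex.differentiableOn_ite_im_le_zero Metric.isOpen_ball ?_ ?_ ?_ ?_ ?_
      · have hT := hW.continuous_holoExt_apply
        have : Continuous fun z : ℂ => holoExt W R (-z - Complex.I) χ :=
          hT.comp ((continuous_neg.sub continuous_const).prodMk continuous_const)
        exact ((innerSL ℂ χ').continuous.comp (S.continuous.comp (e'.continuous.comp
          (Q.continuous.comp (hT.comp (continuous_id.prodMk
            (F.continuous.comp this))))))).continuousOn
      · have hT := hW.continuous_holoExt_apply
        have : Continuous fun z : ℂ => holoExt W R (-z) (e' (Q (S χ))) :=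
          hT.comp (continuous_neg.prodMk continuous_const)
        exact ((innerSL ℂ χ').continuous.comp (hT.comp
          ((continuous_id.sub continuous_const).prodMk (F.continuous.comp this)))).continuousOn
      · rintro z ⟨hz, hz0⟩
        have h1 : (-z - Complex.I).im < 0 := by
          simp only [Complex.sub_im, Complex.neg_im, Complex.I_im]
          linarith [neg_abs_le z.im, him z hz]
        have d1 : DifferentiableAt ℂ (fun z : ℂ => holoExt W R (-z - Complex.I)) z := by
          have d0 : DifferentiableAt ℂ (fun z : ℂ => -z - Complex.I) z := by fun_prop
          exact DifferentiableAt.comp z (f := fun z : ℂ => -z - Complex.I) (hW.differentiableAt_holoExt h1) d0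
        have d2 := F.differentiableAt.comp z (d1.clm_apply (differentiableAt_const χ))
        have d3 := (hW.differentiableAt_holoExt hz0).clm_apply d2
        exact ((innerSL ℂ χ').differentiableAt.comp z (S.differentiableAt.comp z
          (e'.differentiableAt.comp z (Q.differentiableAt.comp z d3)))).differentiableWithinAt
      · rintro z ⟨hz, hz0⟩
        have h1 : (z - Complex.I).im < 0 := by
          simp only [Complex.sub_im, Complex.I_im]
          linarith [le_abs_self z.im, him z hz]
        have h2 : (-z).im < 0 := by
          rw [Complex.neg_im]
          exact neg_lt_zero.2 hz0
        have d1 : DifferentiableAt ℂ (fun z : ℂ => holoExt W R (z - Complex.I)) z := by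
          have d0 : DifferentiableAt ℂ (fun z : ℂ => z - Complex.I) z := by fun_prop
          exact DifferentiableAt.comp z (f := fun z : ℂ => z - Complex.I) (hW.differentiableAt_holoExt h1) d0
        have d2 : DifferentiableAt ℂ (fun z : ℂ => holoExt W R (-z)) z := by
          have d0 : DifferentiableAt ℂ (fun z : ℂ => -z) z := by fun_prop
          exact DifferentiableAt.comp z (f := fun z : ℂ => -z) (hW.differentiableAt_holoExt h2) d0
        have d3 := F.differentiableAt.comp z
          (d2.clm_apply (differentiableAt_const (e' (Q (S χ)))))
        exact ((innerSL ℂ χ').differentiableAt.comp z (d1.clm_apply d3)).differentiableWithinAt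
      · intro z hz hz0
        obtain ⟨x, rfl⟩ : ∃ x : ℝ, z = x := ⟨z.re, Complex.ext rfl (by simp [hz0])⟩
        have hx : |x| < r := by simpa using hz
        have hQx := hQc x (by have := min_le_right η₀ (ε / 2); simp only [η]; linarith)
        have hcx : Commute (e' * Q) (W x * F * W (-x)) := (hc' x (by linarith)).mul_left hQx
        have := DFunLike.congr_fun hcx.eq (S χ)
        simp only [mul_apply_eq_comp] at this
        rw [hf₁, this]
        simp only [f₂, hT2, hT3, innerSL_apply_apply, mul_apply_eq_comp]
    · intro z _
      have b1 : ‖f₁ z‖ ≤ ‖χ'‖ * (‖e'‖ * (‖F‖ * ‖χ‖)) := by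
        refine (norm_inner_le_norm _ _).trans (mul_le_mul_of_nonneg_left ?_ (norm_nonneg _))
        refine (hSn _).trans ((e'.le_opNorm _).trans
          (mul_le_mul_of_nonneg_left ?_ (norm_nonneg _)))
        refine (hQn _).trans ((hTn _ _).trans ((F.le_opNorm _).trans
          (mul_le_mul_of_nonneg_left (hTn _ _) (norm_nonneg _))))
      have b2 : ‖f₂ z‖ ≤ ‖χ'‖ * (‖e'‖ * (‖F‖ * ‖χ‖)) := by
        refine (norm_inner_le_norm _ _).trans (mul_le_mul_of_nonneg_left ?_ (norm_nonneg _))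
        refine (hTn _ _).trans ((F.le_opNorm _).trans ?_)
        rw [mul_left_comm]
        refine mul_le_mul_of_nonneg_left ((hTn _ _).trans ((e'.le_opNorm _).trans
          (mul_le_mul_of_nonneg_left ((hQn _).trans (hSn _)) (norm_nonneg _)))) (norm_nonneg _)
      dsimp only
      split_ifs
      exacts [b1, b2]
    · intro y hy
      obtain ⟨x, hx, rfl⟩ := Finset.mem_map.1 hy
      obtain ⟨hx0, hxη⟩ := hsη x hx
      refine ⟨?_, ?_⟩
      · have := min_le_left η₀ (ε / 2)
        simp only [Function.Embedding.coeFn_mk, Complex.norm_real, Real.norm_eq_abs,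
          abs_of_pos hx0]
        exact hxη.le.trans this
      · have := DFunLike.congr_fun (hQ0 x hx) (S χ)
        simp only [mul_apply_eq_comp, zero_apply] at this
        simp only [Function.Embedding.coeFn_mk, Complex.ofReal_im, le_refl, if_true, hf₁, this,
          map_zero, inner_zero_right]
    · simp only [Complex.ofReal_im, le_refl, if_true, hf₁]
      rw [← inner_sub_right, ← map_sub]
      have h1 : e' ψ = e' ((e ^ n) ψ) := by
        conv_lhs => rw [← heen n]
        rfl
      change ‖inner ℂ χ' (S (e' (Q ψ) - e' ψ))‖ ≤ η₀
      rw [h1, ← map_sub]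
      calc ‖inner ℂ χ' (S (e' (Q ψ - (e ^ n) ψ)))‖
          ≤ ‖χ'‖ * (‖e'‖ * ‖Q ψ - (e ^ n) ψ‖) :=
            (norm_inner_le_norm _ _).trans (mul_le_mul_of_nonneg_left
              ((hSn _).trans (e'.le_opNorm _)) (norm_nonneg _))
        _ ≤ (‖χ'‖ * ‖e'‖ + 1) * (η₀ / (‖χ'‖ * ‖e'‖ + 1)) := by
            rw [← mul_assoc]
            exact mul_le_mul (by linarith) hQψ.le (norm_nonneg _) (by positivity)
        _ = η₀ := by field_simp
  have hd := IsSelfAdjoint.denseRange (hW.isSelfAdjoint_decay 1)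
    (fun ψ hψ => hW.decay_injective one_pos hψ)
  have small' : ∀ t : ℝ, |t| < r / 2 → e' * W t * F = 0 := by
    intro t ht
    have h1 : e' * W t * F * W (-t) = 0 := by
      refine ContinuousLinearMap.ext fun φ => ?_
      refine congrFun (hd.equalizer (e' * W t * F * W (-t)).continuous
        (0 : H →L[ℂ] H).continuous (funext fun χ => ?_)) φ
      refine hW.decay_injective one_pos ?_
      exact inner_self_eq_zero.1 (small t ht χ _)
    calc e' * W t * F = e' * W t * F * (W (-t) * W t) := by rw [hW.apply_neg_mul, mul_one]
      _ = e' * W t * F * W (-t) * W t := by simp only [mul_assoc]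
      _ = 0 := by rw [h1, zero_mul]
  have all := hW.mul_mul_eq_zero (X := e') (Y := F) (a := -(r / 2)) (b := r / 2) (by linarith)
    (fun s hs => small' s (abs_lt.2 hs)) t
  rw [← mul_assoc, ← mul_assoc, all, zero_mul]

end IsPositiveGroup

end Borchers

/-! ### Unitary groups whose generator is bounded from below -/

section Resolvent

variable {H : Type*} [NormedAddCommGroup H] [InnerProductSpace ℂ H]

/-- `R` is the resolvent `(K - l)⁻¹` of the generator `K` of the one-parameter group `W`, at the
real point `l`. In terms of `W`, the relation `K φ = χ` says that `W t φ` has the derivative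
`-i χ` at `t = 0`. -/
structure IsResolvent (W : ℝ → H →L[ℂ] H) (l : ℝ) (R : H →L[ℂ] H) : Prop where
  right_inv : ∀ ψ, HasDerivAt (fun t => W t (R ψ)) (-Complex.I • (ψ + (l : ℂ) • R ψ)) 0
  left_inv : ∀ φ φ', HasDerivAt (fun t => W t φ) φ' 0 → R (Complex.I • φ' - (l : ℂ) • φ) = φ

lemma exists_isResolvent {W : ℝ → H →L[ℂ] H} {l : ℝ}
    (hl : (l : ℂ) ∉ Minkowski.unboundedSpectrum (Minkowski.generator W)) :
    ∃ R, IsResolvent W l R := by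
  simp only [Minkowski.unboundedSpectrum, Set.mem_ofPred_eq, not_not] at hl
  obtain ⟨R, h1, h2⟩ := hl
  refine ⟨R, fun ψ => ?_, fun φ φ' hφ => ?_⟩
  · obtain ⟨hψ, h⟩ := h1 ψ
    have hd : DifferentiableAt ℝ (fun t => W t (R ψ)) 0 := hψ
    replace h : Complex.I • deriv (fun t => W t (R ψ)) 0 - (l : ℂ) • R ψ = ψ := h
    refine hd.hasDerivAt.congr_deriv ?_
    rw [← sub_eq_iff_eq_add.1 h, smul_smul]
    simp
  · have hd : φ ∈ (Minkowski.generator W).domain := hφ.differentiableAt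
    have h : R (Complex.I • deriv (fun t => W t φ) 0 - (l : ℂ) • φ) = φ := h2 ⟨φ, hd⟩
    rwa [hφ.deriv] at h

namespace IsResolvent

variable {W : ℝ → H →L[ℂ] H} {l m : ℝ} {R R' : H →L[ℂ] H}

lemma hasDerivAt (hR : IsResolvent W l R) (hadd : ∀ s t, W (s + t) = W s * W t) (ψ : H) (t : ℝ) :
    HasDerivAt (fun t => W t (R ψ)) (W t (-Complex.I • (ψ + (l : ℂ) • R ψ))) t := by
  have h1 := ((W t).restrictScalars ℝ).hasFDerivAt.comp_hasDerivAt (0 : ℝ) (hR.right_inv ψ)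
  have h2 : HasDerivAt (fun s => W (t + s) (R ψ)) (W t (-Complex.I • (ψ + (l : ℂ) • R ψ))) 0 := by
    refine h1.congr_of_eventuallyEq (Filter.Eventually.of_forall fun s => ?_)
    exact DFunLike.congr_fun (hadd t s) (R ψ)
  have h3 : HasDerivAt (fun s => W (t + s) (R ψ)) (W t (-Complex.I • (ψ + (l : ℂ) • R ψ)))
      (-t + t) := by rwa [neg_add_cancel]
  simpa using h3.comp_const_add (-t) t

lemma commute (hR : IsResolvent W l R) (hadd : ∀ s t, W (s + t) = W s * W t) (s : ℝ) :
    Commute (W s) R := by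
  ext ψ
  have h1 := ((W s).restrictScalars ℝ).hasFDerivAt.comp_hasDerivAt (0 : ℝ) (hR.right_inv ψ)
  have h2 : HasDerivAt (fun t => W t (W s (R ψ))) (W s (-Complex.I • (ψ + (l : ℂ) • R ψ))) 0 := by
    refine h1.congr_of_eventuallyEq (Filter.Eventually.of_forall fun t => ?_)
    have : W t * W s = W s * W t := by rw [← hadd, ← hadd, add_comm]
    exact DFunLike.congr_fun this (R ψ)
  have h3 := hR.left_inv _ _ h2
  have e : Complex.I • W s (-Complex.I • (ψ + (l : ℂ) • R ψ)) - (l : ℂ) • W s (R ψ) = W s ψ := by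
    simp [smul_smul]
  rw [e] at h3
  exact h3.symm

lemma resolvent_identity (hR : IsResolvent W l R) (hR' : IsResolvent W m R') :
    R' - R = ((m : ℂ) - l) • (R * R') := by
  ext ψ
  have := hR.left_inv _ _ (hR'.right_inv ψ)
  rw [smul_smul] at this
  have e : (Complex.I * -Complex.I) • (ψ + (m : ℂ) • R' ψ) - (l : ℂ) • R' ψ
      = ψ + ((m : ℂ) - l) • R' ψ := by
    have : Complex.I * -Complex.I = 1 := by simp
    rw [this, one_smul, sub_smul]
    abel
  rw [e, map_add, map_smul] at this
  simp only [sub_apply, smul_apply, mul_apply_eq_comp]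
  rw [sub_eq_iff_eq_add, add_comm]
  exact this.symm

lemma injective (hR : IsResolvent W l R) {ψ : H} (hψ : R ψ = 0) : ψ = 0 := by
  have h := hR.right_inv ψ
  simp only [hψ, map_zero, smul_zero, add_zero] at h
  have := h.unique (hasDerivAt_const (0 : ℝ) (0 : H))
  simpa using this

variable [CompleteSpace H]

lemma isSelfAdjoint (hR : IsResolvent W l R) (h0 : W 0 = 1)
    (hnorm : ∀ t ψ, ‖W t ψ‖ = ‖ψ‖) : IsSelfAdjoint R := by
  rw [ContinuousLinearMap.isSelfAdjoint_iff_isSymmetric]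
  intro ψ φ
  have h1 := (hR.right_inv ψ).inner ℂ (hR.right_inv φ)
  have h2 : ∀ t, inner ℂ (W t (R ψ)) (W t (R φ)) = inner ℂ (R ψ) (R φ) := fun t =>
    LinearIsometry.inner_map_map ⟨(W t : H →ₗ[ℂ] H), hnorm t⟩ _ _
  simp only [h2, h0, one_apply_eq_self] at h1
  have h3 := h1.unique (hasDerivAt_const (0 : ℝ) (inner ℂ (R ψ) (R φ)))
  simp only [inner_smul_left, inner_smul_right, inner_add_left, inner_add_right, map_neg,
    Complex.conj_I, Complex.conj_ofReal] at h3
  have h4 : Complex.I * (inner ℂ (R ψ) φ - inner ℂ ψ (R φ)) = 0 := by linear_combination -h3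
  exact sub_eq_zero.1 ((mul_eq_zero.1 h4).resolve_left Complex.I_ne_zero)

/-- If `(-∞, l]` belongs to the resolvent set, then `(K - l)⁻¹` is positive: a negative number `m`
in its spectrum would give `l + 1 / m` in the spectrum of `K`. -/
lemma nonneg (hR : IsResolvent W l R) (h0 : W 0 = 1) (hnorm : ∀ t ψ, ‖W t ψ‖ = ‖ψ‖)
    (hres : ∀ m < l, ∃ R', IsResolvent W m R') : 0 ≤ R := by
  rw [StarOrderedRing.nonneg_iff_spectrum_nonneg (R := ℝ) R (hR.isSelfAdjoint h0 hnorm)]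
  intro m hm
  by_contra! hneg
  have hm0 : (m : ℂ) ≠ 0 := by exact_mod_cast hneg.ne
  obtain ⟨R', hR'⟩ := hres (l + m⁻¹) (by linarith [inv_neg''.2 hneg])
  have e1 := hR.resolvent_identity hR'
  have e2 := hR'.resolvent_identity hR
  simp only [Complex.ofReal_add, Complex.ofReal_inv, add_sub_cancel_left, sub_add_cancel_left]
    at e1 e2
  replace e1 : R * R' = (m : ℂ) • (R' - R) := by rw [e1, smul_smul, mul_inv_cancel₀ hm0, one_smul]
  replace e2 : R' * R = (m : ℂ) • (R' - R) := by
    rw [← neg_sub R R', e2, neg_smul, neg_neg, smul_smul, mul_inv_cancel₀ hm0, one_smul]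
  refine spectrum.mem_iff.1 hm ?_
  have ea : algebraMap ℝ (H →L[ℂ] H) m = (m : ℂ) • 1 := by
    ext ψ
    simp [Algebra.algebraMap_eq_smul_one]
  rw [ea]
  refine ⟨⟨(m : ℂ) • 1 - R, (m : ℂ)⁻¹ • (1 + (m : ℂ)⁻¹ • R'), ?_, ?_⟩, rfl⟩
  · simp only [sub_mul, mul_add, smul_mul_assoc, mul_smul_comm, one_mul, mul_one, e1]
    match_scalars <;> field_simp <;> ring
  · simp only [mul_sub, add_mul, smul_mul_assoc, mul_smul_comm, one_mul, mul_one, e2]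
    match_scalars <;> field_simp <;> ring

end IsResolvent

/-- A strongly continuous unitary group whose generator has spectrum bounded from below becomes,
after multiplication with a phase `exp (i c t)`, one with a positive generator. -/
theorem exists_isPositiveGroup [CompleteSpace H] {W : ℝ → H →L[ℂ] H} (h0 : W 0 = 1)
    (hadd : ∀ s t, W (s + t) = W s * W t) (hnorm : ∀ t ψ, ‖W t ψ‖ = ‖ψ‖)
    (hcont : ∀ ψ, Continuous fun t => W t ψ)
    (hb : BddBelow {E : ℝ | (E : ℂ) ∈ Minkowski.unboundedSpectrum (Minkowski.generator W)}) :
    ∃ (c : ℝ) (R : H →L[ℂ] H),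
      IsPositiveGroup (fun t => Complex.exp (Complex.I * c * t) • W t) R := by
  obtain ⟨b, hb⟩ := hb
  have hres : ∀ l < b, ∃ R, IsResolvent W l R := fun l hl =>
    exists_isResolvent fun h => absurd (hb h) (not_le.2 hl)
  obtain ⟨R, hR⟩ := hres (b - 1) (by linarith)
  set c : ℝ := b - 1
  have hexp : ∀ t : ℝ, ‖Complex.exp (Complex.I * c * t)‖ = 1 := fun t => by
    rw [Complex.norm_exp]
    simp
  refine ⟨c, R, ⟨?_, ?_, ?_, ?_, ?_, ?_, ?_, ?_⟩⟩
  · simp [h0]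
  · intro s t
    rw [hadd, smul_mul_smul_comm, ← Complex.exp_add]
    push_cast
    ring_nf
  · intro t ψ
    rw [smul_apply, norm_smul, hexp, one_mul, hnorm]
  · intro ψ
    exact (by fun_prop : Continuous fun t : ℝ => Complex.exp (Complex.I * c * t)).smul (hcont ψ)
  · exact hR.nonneg h0 hnorm fun m hm => hres m (by linarith)
  · exact fun ψ => hR.injective
  · exact fun t => (hR.commute hadd t).smul_left _
  · intro ψ t
    have h1 : HasDerivAt (fun t : ℝ => Complex.exp (Complex.I * c * t))
        (Complex.exp (Complex.I * c * t) * (Complex.I * c)) t := by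
      have : HasDerivAt (fun z : ℂ => Complex.exp (Complex.I * c * z))
          (Complex.exp (Complex.I * c * t) * (Complex.I * c * 1)) (t : ℂ) :=
        ((hasDerivAt_id (t : ℂ)).const_mul _).cexp
      simpa using this.comp_ofReal
    refine (h1.smul (hR.hasDerivAt hadd ψ t)).congr_deriv ?_
    simp only [map_smul, map_add, smul_add, smul_smul, smul_apply]
    module

end Resolvent

/-! ### Cut-offs of effects -/

section Cutoffs

variable {H : Type*} [NormedAddCommGroup H] [InnerProductSpace ℂ H] [CompleteSpace H]

/-- A continuous cut-off function, equal to `1` on `[3/4, ∞)` and supported in `[5/8, ∞)`. -/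
noncomputable def plateau (x : ℝ) : ℝ := max 0 (min 1 (8 * (x - 5 / 8)))

/-- The positive part of `x - 3/4`. -/
noncomputable def excess (x : ℝ) : ℝ := max (x - 3 / 4) 0

lemma continuous_plateau : Continuous plateau := by unfold plateau; fun_prop

lemma continuous_excess : Continuous excess := by unfold excess; fun_prop

lemma excess_mul_plateau (x : ℝ) : excess x * plateau x = excess x := by
  unfold excess plateau
  rcases le_total x (3 / 4) with h | h
  · rw [max_eq_right (by linarith), zero_mul]
  · rw [min_eq_left (by linarith), max_eq_right zero_le_one, mul_one]

lemma cfc_excess_mul_cfc_plateau (A : H →L[ℂ] H) :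
    cfc excess A * cfc plateau A = cfc excess A := by
  rw [← cfc_mul excess plateau A continuous_excess.continuousOn continuous_plateau.continuousOn]
  exact cfc_congr fun x _ => excess_mul_plateau x

lemma norm_cfc_plateau_le (A : H →L[ℂ] H) : ‖cfc plateau A‖ ≤ 1 :=
  norm_cfc_le zero_le_one fun x _ => by
    rw [Real.norm_eq_abs, abs_of_nonneg (le_max_left _ _)]
    exact max_le zero_le_one (min_le_left _ _)

/-- If `f` is supported in `[c, ∞)`, then `A ≥ c` on the range of `f(A)`. -/
lemma mul_norm_sq_cfc_le {A : H →L[ℂ] H} (hA : IsSelfAdjoint A) {f : ℝ → ℝ} (hf : Continuous f)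
    {c : ℝ} (hc : ∀ x, f x ≠ 0 → c ≤ x) (ψ : H) :
    c * ‖cfc f A ψ‖ ^ 2 ≤ (inner ℂ (cfc f A ψ) (A (cfc f A ψ))).re := by
  have h1 : 0 ≤ cfc (fun x => f x * ((x - c) * f x)) A := by
    refine cfc_nonneg fun x _ => ?_
    by_cases hx : f x = 0
    · simp [hx]
    · nlinarith [mul_self_nonneg (f x), hc x hx,
        mul_nonneg (sub_nonneg.2 (hc x hx)) (mul_self_nonneg (f x))]
  rw [cfc_mul f (fun x => (x - c) * f x) A hf.continuousOn (by fun_prop),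
    cfc_mul (fun x => x - c) f A (by fun_prop) hf.continuousOn,
    cfc_sub (fun x => x) (fun _ => c) A (by fun_prop) (by fun_prop), cfc_id' ℝ A,
    cfc_const c A hA] at h1
  have h2 := ((ContinuousLinearMap.nonneg_iff_isPositive _).1 h1).re_inner_nonneg_right ψ
  have hs := ContinuousLinearMap.isSelfAdjoint_iff_isSymmetric.1
    (cfc_predicate f A : IsSelfAdjoint (cfc f A))
  simp only [mul_apply_eq_comp] at h2
  have h3 := hs ψ ((A - algebraMap ℝ (H →L[ℂ] H) c) (cfc f A ψ))
  simp only [ContinuousLinearMap.coe_coe] at h3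
  rw [← h3, sub_apply, inner_sub_right, Algebra.algebraMap_eq_smul_one] at h2
  have h4 : (inner ℂ (cfc f A ψ) ((c • (1 : H →L[ℂ] H)) (cfc f A ψ))).re
      = c * ‖cfc f A ψ‖ ^ 2 := by
    rw [smul_apply, one_apply_eq_self, RCLike.real_smul_eq_coe_smul (K := ℂ), inner_smul_right,
      inner_self_eq_norm_sq_to_K]
    norm_cast
  rw [map_sub] at h2
  change 0 ≤ Complex.re _ - Complex.re _ at h2
  linarith

/-- The cut-offs of two commuting effects with `A + B ≤ 1` are orthogonal, since `A` and `B` are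
both larger than `1/2` on the range of their product. -/
lemma cfc_plateau_mul_cfc_excess {A B : H →L[ℂ] H} (hA : IsSelfAdjoint A) (hB : IsSelfAdjoint B)
    (hAB : Commute A B) (hle : ∀ w, (inner ℂ w (A w)).re + (inner ℂ w (B w)).re ≤ ‖w‖ ^ 2) :
    cfc plateau A * cfc excess B = 0 := by
  have hc : Commute (cfc plateau A) (cfc excess B) := by
    have h1 : Commute (cfc plateau A) B := Commute.cfc hAB (by rwa [hA.star_eq]) _
    exact (Commute.cfc h1.symm (by rw [hB.star_eq]; exact h1.symm) _).symm
  ext χ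
  set w : H := (cfc plateau A * cfc excess B) χ
  have hw1 : w = cfc plateau A (cfc excess B χ) := rfl
  have hw2 : w = cfc excess B (cfc plateau A χ) := DFunLike.congr_fun hc.eq χ
  have h1 := mul_norm_sq_cfc_le hA continuous_plateau (c := 5 / 8) (fun x hx => by
    by_contra! h
    refine hx (max_eq_left ?_)
    exact (min_le_right _ _).trans (by linarith)) (cfc excess B χ)
  have h2 := mul_norm_sq_cfc_le hB continuous_excess (c := 5 / 8) (fun x hx => by
    by_contra! h
    exact hx (max_eq_right (by linarith))) (cfc plateau A χ)
  rw [← hw1] at h1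
  rw [← hw2] at h2
  have h3 : ‖w‖ ^ 2 ≤ 0 := by linarith [hle w]
  have h4 : ‖w‖ = 0 := by nlinarith [norm_nonneg w]
  exact norm_eq_zero.1 h4

lemma re_inner_le_of_cfc_excess_eq_zero {A : H →L[ℂ] H} (hA : IsSelfAdjoint A)
    (h0 : cfc excess A = 0) (ψ : H) : (inner ℂ ψ (A ψ)).re ≤ 3 / 4 * ‖ψ‖ ^ 2 := by
  have h1 : 0 ≤ cfc (fun x => excess x - (x - 3 / 4)) A :=
    cfc_nonneg fun x _ => sub_nonneg.2 (le_max_left _ _)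
  rw [cfc_sub excess (fun x => x - 3 / 4) A continuous_excess.continuousOn (by fun_prop),
    cfc_sub (fun x => x) (fun _ => 3 / 4) A (by fun_prop) (by fun_prop), cfc_id' ℝ A,
    cfc_const _ A hA, h0, zero_sub, neg_sub] at h1
  have h2 := ((ContinuousLinearMap.nonneg_iff_isPositive _).1 h1).re_inner_nonneg_right ψ
  rw [sub_apply, inner_sub_right, Algebra.algebraMap_eq_smul_one, smul_apply, one_apply_eq_self,
    RCLike.real_smul_eq_coe_smul (K := ℂ), inner_smul_right, inner_self_eq_norm_sq_to_K, map_sub] at h2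
  change 0 ≤ Complex.re _ - Complex.re _ at h2
  have h3 : ((((3 / 4 : ℝ) : ℂ)) * (‖ψ‖ : ℂ) ^ 2).re = 3 / 4 * ‖ψ‖ ^ 2 := by norm_cast
  exact sub_nonneg.1 (h2.trans_eq (by rw [← h3]; rfl))

lemma conj_cfc (V : unitary (H →L[ℂ] H)) {f : ℝ → ℝ} (hf : Continuous f) {A : H →L[ℂ] H}
    (hA : IsSelfAdjoint A) :
    (V : H →L[ℂ] H) * cfc f A * ((V⁻¹ : unitary (H →L[ℂ] H)) : H →L[ℂ] H)
      = cfc f ((V : H →L[ℂ] H) * A * ((V⁻¹ : unitary (H →L[ℂ] H)) : H →L[ℂ] H)) := by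
  have hA' : IsSelfAdjoint (Unitary.conjStarAlgAut ℂ (H →L[ℂ] H) V A) :=
    hA.conjugate (V : H →L[ℂ] H)
  have hcont : Continuous (Unitary.conjStarAlgAut ℂ (H →L[ℂ] H) V) := by
    change Continuous fun x => (V : H →L[ℂ] H) * x * (star V : H →L[ℂ] H)
    fun_prop
  exact StarAlgHomClass.map_cfc (S := ℂ) (Unitary.conjStarAlgAut ℂ (H →L[ℂ] H) V) f A
    hf.continuousOn hcont hA hA'

end Cutoffs

/-! ### Normalized POVMs -/

namespace Minkowski.IsPOVM

variable {H : Type*} [NormedAddCommGroup H] [InnerProductSpace ℂ H]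
variable {X : Set Spacetime} {E : Set Spacetime → H →L[ℂ] H}

lemma inner_empty (hE : IsPOVM X E) (ψ : H) : inner ℂ ψ (E ∅ ψ) = 0 := by
  have h := hE.sigma_additive (fun _ => ∅) (fun _ => Set.empty_subset _)
    (fun _ => MeasurableSet.empty) (fun _ _ _ => disjoint_bot_left) ψ
  exact tendsto_nhds_unique tendsto_const_nhds h.summable.tendsto_atTop_zero

lemma inner_union (hE : IsPOVM X E) {B C : Set Spacetime} (hB : B ⊆ X) (hC : C ⊆ X)
    (hB' : MeasurableSet B) (hC' : MeasurableSet C) (hBC : Disjoint B C) (ψ : H) :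
    inner ℂ ψ (E (B ∪ C) ψ) = inner ℂ ψ (E B ψ) + inner ℂ ψ (E C ψ) := by
  set D : ℕ → Set Spacetime := fun n => if n = 0 then B else if n = 1 then C else ∅
  have hU : ⋃ n, D n = B ∪ C := by
    ext x
    simp only [Set.mem_iUnion, Set.mem_union, D]
    constructor
    · rintro ⟨n, hn⟩
      split_ifs at hn
      exacts [Or.inl hn, Or.inr hn, hn.elim]
    · rintro (h | h)
      exacts [⟨0, by simpa using h⟩, ⟨1, by simpa using h⟩]
  have h := hE.sigma_additive D (fun n => by simp only [D]; split_ifs <;> simp [hB, hC])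
    (fun n => by simp only [D]; split_ifs <;> simp [hB', hC']) (by
      intro i j hij
      simp only [Function.onFun, D]
      split_ifs <;> first | omega | simp [hBC.symm]) ψ
  rw [hU] at h
  have h2 := hasSum_sum_of_ne_finset_zero (L := .unconditional ℕ) (f := fun n => inner ℂ ψ (E (D n) ψ))
    (s := Finset.range 2) (fun n hn => by
      simp only [Finset.mem_range, not_lt] at hn
      have : D n = ∅ := by
        simp only [D]
        rw [if_neg (by omega), if_neg (by omega)]
      rw [this, hE.inner_empty])
  rw [h.unique h2]
  simp [Finset.sum_range_succ, D]

variable [CompleteSpace H]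

lemma isSelfAdjoint (hE : IsPOVM X E) {B : Set Spacetime} (hB : B ⊆ X) (hB' : MeasurableSet B) :
    IsSelfAdjoint (E B) := IsSelfAdjoint.of_nonneg (hE.nonneg B hB hB')

lemma re_inner_add_le (hE : IsPOVM X E) {B C : Set Spacetime} (hB : B ⊆ X) (hC : C ⊆ X)
    (hB' : MeasurableSet B) (hC' : MeasurableSet C) (hBC : Disjoint B C) (ψ : H) :
    (inner ℂ ψ (E B ψ)).re + (inner ℂ ψ (E C ψ)).re ≤ ‖ψ‖ ^ 2 := by
  have h1 := hE.le_one (B ∪ C) (Set.union_subset hB hC) (hB'.union hC')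
  rw [← sub_nonneg] at h1
  have h2 := ((ContinuousLinearMap.nonneg_iff_isPositive _).1 h1).re_inner_nonneg_right ψ
  rw [sub_apply, inner_sub_right, one_apply_eq_self, hE.inner_union hB hC hB' hC' hBC,
    inner_self_eq_norm_sq_to_K, map_sub, map_add] at h2
  have h3 : RCLike.re ((‖ψ‖ : ℂ) ^ 2) = ‖ψ‖ ^ 2 := by
    change ((‖ψ‖ : ℂ) ^ 2).re = _
    norm_cast
  have h4 := h2.trans_eq (congrArg₂ (· - ·) h3 rfl)
  exact sub_nonneg.1 h4

/-- By normalization, the effect of a large bounded region has norm larger than `3/4`. -/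
lemma exists_cfc_excess_ne_zero [Nontrivial H] (hE : IsPOVM X E) (hX : MeasurableSet X) :
    ∃ n : ℕ, cfc excess (E {x ∈ X | ⌊‖x‖⌋₊ < n}) ≠ 0 := by
  by_contra! hcon
  obtain ⟨ψ, hψ⟩ := exists_ne (0 : H)
  have hfl : Measurable fun x : Spacetime => ⌊‖x‖⌋₊ := Nat.measurable_floor.comp measurable_norm
  have hm : ∀ n, MeasurableSet {x ∈ X | ⌊‖x‖⌋₊ < n} := fun n =>
    hX.inter (hfl measurableSet_Iio)
  have hm' : ∀ n, MeasurableSet {x ∈ X | ⌊‖x‖⌋₊ = n} := fun n =>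
    hX.inter (hfl (measurableSet_singleton n))
  have h := hE.sigma_additive (fun n => {x ∈ X | ⌊‖x‖⌋₊ = n}) (fun n => Set.sep_subset _ _)
    hm' (fun i j hij => Set.disjoint_left.2 fun x hi hj => hij (hi.2.symm.trans hj.2)) ψ
  have hU : ⋃ n, {x ∈ X | ⌊‖x‖⌋₊ = n} = X := by
    ext x
    simp
  have hsum : ∀ n, ∑ k ∈ Finset.range n, inner ℂ ψ (E {x ∈ X | ⌊‖x‖⌋₊ = k} ψ)
      = inner ℂ ψ (E {x ∈ X | ⌊‖x‖⌋₊ < n} ψ) := by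
    intro n
    induction n with
    | zero =>
      have : {x ∈ X | ⌊‖x‖⌋₊ < 0} = ∅ := by ext x; simp
      rw [Finset.range_zero, Finset.sum_empty, this, hE.inner_empty]
    | succ n ih =>
      rw [Finset.sum_range_succ, ih, ← hE.inner_union (Set.sep_subset _ _) (Set.sep_subset _ _)
        (hm n) (hm' n) (Set.disjoint_left.2 fun x hi hj => hi.2.ne hj.2)]
      congr 3
      ext x
      simp only [Set.mem_union, Set.mem_ofPred_eq, Nat.lt_succ_iff_lt_or_eq]
      tauto
  have hlim := h.tendsto_sum_nat
  rw [hU, hE.normalized, one_apply_eq_self, inner_self_eq_norm_sq_to_K] at hlim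
  have hre := (Complex.continuous_re.tendsto _).comp hlim
  have hle := le_of_tendsto' hre (b := 3 / 4 * ‖ψ‖ ^ 2) fun n => by
    simp only [Function.comp_apply, hsum]
    exact re_inner_le_of_cfc_excess_eq_zero
      (hE.isSelfAdjoint (Set.sep_subset _ _) (hm n)) (hcon n) ψ
  have h3 : ((‖ψ‖ : ℂ) ^ 2).re = ‖ψ‖ ^ 2 := by norm_cast
  have h4 : ‖ψ‖ ^ 2 ≤ 3 / 4 * ‖ψ‖ ^ 2 := h3.symm.trans_le hle
  have : 0 < ‖ψ‖ := norm_pos_iff.2 hψ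
  nlinarith [pow_pos this 2]

end Minkowski.IsPOVM

namespace Minkowski

/-! ### Spacelike planes and timelike vectors -/

lemma continuous_metric : Continuous fun p : Spacetime × Spacetime => metric p.1 p.2 := by
  unfold metric
  fun_prop

lemma metric_smul_smul (c : ℝ) (x : Spacetime) : metric (c • x) (c • x) = c ^ 2 * metric x x := by
  simp only [metric, Pi.smul_apply, smul_eq_mul]
  ring

lemma IsSpacelikePlane.exists_le_metric {P : AffineSubspace ℝ Spacetime}
    (hP : IsSpacelikePlane P) : ∃ κ > 0, ∀ w ∈ P.direction, κ * ‖w‖ ^ 2 ≤ metric w w := by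
  have : Nontrivial P.direction := Module.nontrivial_of_finrank_pos (R := ℝ) (by rw [hP.1]; norm_num)
  obtain ⟨w₀, hw₀, hmin⟩ := (isCompact_sphere (0 : P.direction) 1).exists_isMinOn
    (NormedSpace.sphere_nonempty.2 zero_le_one)
    (f := fun w : P.direction => metric (w : Spacetime) w)
    (continuous_metric.comp (continuous_subtype_val.prodMk continuous_subtype_val)).continuousOn
  have hw₀' : w₀ ≠ 0 := by
    rintro rfl
    simp at hw₀
  refine ⟨metric w₀ w₀, hP.2 w₀ w₀.2 (by simpa using hw₀'), fun w hw => ?_⟩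
  by_cases hw0 : w = 0
  · simp [hw0, metric]
  have hn : 0 < ‖w‖ := norm_pos_iff.2 hw0
  have h1 := hmin (a := ‖w‖⁻¹ • ⟨w, hw⟩) (by
    rw [mem_sphere_zero_iff_norm, norm_smul, norm_inv, norm_norm, Submodule.coe_norm]
    exact inv_mul_cancel₀ hn.ne')
  simp only [Set.mem_ofPred_eq, Submodule.coe_smul, metric_smul_smul] at h1
  rw [inv_pow, inv_mul_eq_div, le_div_iff₀ (by positivity)] at h1
  exact h1

lemma IsSpacelikePlane.exists_mem_direction_add_smul {P : AffineSubspace ℝ Spacetime}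
    (hP : IsSpacelikePlane P) {u : Spacetime} (hu : FutureTimelike u) (w : Spacetime) :
    ∃ a ∈ P.direction, ∃ c : ℝ, w = a + c • u := by
  have hu0 : u ≠ 0 := by
    rintro rfl
    simp [FutureTimelike, metric] at hu
  have hud : u ∉ P.direction := fun h => lt_asymm hu.1 (hP.2 u h hu0)
  have hdisj : P.direction ⊓ Submodule.span ℝ {u} = ⊥ := by
    rw [← disjoint_iff, Submodule.disjoint_span_singleton' hu0]
    exact hud
  have hfr := Submodule.finrank_sup_add_finrank_inf_eq P.direction (Submodule.span ℝ {u})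
  rw [hdisj, finrank_bot, hP.1, finrank_span_singleton hu0] at hfr
  have htop : P.direction ⊔ Submodule.span ℝ {u} = ⊤ := by
    apply Submodule.eq_top_of_finrank_eq
    simpa using hfr
  obtain ⟨a, ha, b, hb, hab⟩ := Submodule.mem_sup.1 (htop ▸ Submodule.mem_top : w ∈ _ ⊔ _)
  obtain ⟨c, rfl⟩ := Submodule.mem_span_singleton.1 hb
  exact ⟨a, ha, c, hab.symm⟩

/-- The boost with velocity `3/5` in the direction of the first space coordinate. -/
noncomputable def boostEquiv : Spacetime ≃ₗ[ℝ] Spacetime where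
  toFun x := ![5 / 4 * x 0 + 3 / 4 * x 1, 3 / 4 * x 0 + 5 / 4 * x 1, x 2, x 3]
  invFun x := ![5 / 4 * x 0 - 3 / 4 * x 1, -(3 / 4 * x 0) + 5 / 4 * x 1, x 2, x 3]
  map_add' x y := by
    ext i; fin_cases i <;> simp <;> ring
  map_smul' c x := by
    ext i; fin_cases i <;> simp <;> ring
  left_inv x := by
    ext i; fin_cases i <;> simp <;> ring
  right_inv x := by
    ext i; fin_cases i <;> simp <;> ring

lemma boostEquiv_apply (x : Spacetime) :
    boostEquiv x = ![5 / 4 * x 0 + 3 / 4 * x 1, 3 / 4 * x 0 + 5 / 4 * x 1, x 2, x 3] := rfl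

lemma metric_boostEquiv (x y : Spacetime) :
    metric (boostEquiv x) (boostEquiv y) = metric x y := by
  simp only [metric, boostEquiv_apply, Matrix.cons_val]
  ring

lemma futureTimelike_boostEquiv (x : Spacetime) :
    FutureTimelike (boostEquiv x) ↔ FutureTimelike x := by
  rw [FutureTimelike, FutureTimelike, metric_boostEquiv]
  refine and_congr_right fun hx => ?_
  have h0 : boostEquiv x 0 = 5 / 4 * x 0 + 3 / 4 * x 1 := rfl
  have h1 : x 1 ^ 2 < x 0 ^ 2 := by
    simp only [metric] at hx
    nlinarith [sq_nonneg (x 2), sq_nonneg (x 3)]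
  have h2 := abs_lt.1 (sq_lt_sq.1 h1)
  rw [h0]
  constructor
  · intro h
    by_contra! h3
    rw [abs_of_nonpos h3] at h2
    linarith [h2.2]
  · intro h
    rw [abs_of_pos h] at h2
    linarith [h2.1]

/-- The boost as an element of the Poincaré group. -/
noncomputable def boost : OrthochronousPoincare :=
  ⟨boostEquiv.toAffineEquiv, metric_boostEquiv, futureTimelike_boostEquiv⟩

/-- Some proper orthochronous transformation changes the direction of a timelike vector. -/
lemma exists_properPoincare_linear_ne_smul {u : Spacetime} (hu : FutureTimelike u) :
    ∃ h ∈ ProperPoincare, ∀ c : ℝ, h.1.linear u ≠ c • u := by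
  -- the square of a boost, so that its determinant is a square
  refine ⟨boost * boost, ?_, fun c hc => ?_⟩
  · change 0 < LinearMap.det ((boostEquiv : Spacetime →ₗ[ℝ] Spacetime) ∘ₗ
      (boostEquiv : Spacetime →ₗ[ℝ] Spacetime))
    rw [LinearMap.det_comp]
    exact mul_self_pos.2 (LinearEquiv.isUnit_det' boostEquiv).ne_zero
  · replace hc : boostEquiv (boostEquiv u) = c • u := hc
    have h0 := congrFun hc 0
    have h1 := congrFun hc 1
    simp only [boostEquiv_apply, Matrix.cons_val, Pi.smul_apply, smul_eq_mul] at h0 h1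
    have h2 := hu.1
    simp only [metric] at h2
    have h3 : u 0 ^ 2 = u 1 ^ 2 := by linear_combination (8 / 15) * (u 0 * h1 - u 1 * h0)
    nlinarith [sq_nonneg (u 2), sq_nonneg (u 3)]

lemma exists_map_linear_ne_smul {G : Type*} [Group G] [TopologicalSpace G]
    {π : G →* OrthochronousPoincare} (hπ : IsSymmetryGroup π) {u : Spacetime}
    (hu : FutureTimelike u) : ∃ g : G, ∀ c : ℝ, (π g).1.linear u ≠ c • u := by
  obtain ⟨h, hh, hne⟩ := exists_properPoincare_linear_ne_smul hu
  have : ∃ g, π g = h := by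
    rcases hπ with hπ | hπ
    · exact hπ.surjective h
    · exact MonoidHom.mem_range.1 (hπ.2.1 ▸ hh)
  obtain ⟨g, rfl⟩ := this
  exact ⟨g, hne⟩

lemma conj_translation (h : OrthochronousPoincare) (a : Spacetime) :
    h * translation a * h⁻¹ = translation (h.1.linear a) := by
  rw [mul_inv_eq_iff_eq_mul]
  ext1
  refine AffineEquiv.ext fun x => ?_
  change h.1 (a +ᵥ x) = h.1.linear a +ᵥ h.1 x
  exact h.1.map_vadd x a

lemma tensorAction_translation {p q : ℕ} (a : Spacetime) (v : Tensor p q) :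
    tensorAction (translation a) v = v := by
  have h : tensorAction (p := p) (q := q) (translation a) = LinearMap.id := by
    have h1 : ((translation a).1.linear : Spacetime →ₗ[ℝ] Spacetime) = LinearMap.id := rfl
    have h2 : ((translation a).1.linear.symm : Spacetime →ₗ[ℝ] Spacetime) = LinearMap.id := rfl
    rw [tensorAction, h1, h2]
    simp only [LinearMap.dualMap_id, PiTensorProduct.map_id, TensorProduct.map_id]
  rw [h, LinearMap.id_apply]

/-! ### Covariance under translations -/

variable {G : Type*} [Group G] [TopologicalSpace G] {π : G →* OrthochronousPoincare}
  {H : Type*} [NormedAddCommGroup H] [InnerProductSpace ℂ H] [CompleteSpace H]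

lemma LocalizationObservable.covariant_translation (L : LocalizationObservable π H) {g : G}
    {b : Spacetime} (hg : π g = translation b) {v : Tensor L.p L.q} (hv : v ∈ L.S)
    {P : AffineSubspace ℝ Spacetime} (hP : IsSpacelikePlane P) {Δ : Set Spacetime} (hΔ : Δ ⊆ P)
    (hm : MeasurableSet Δ) :
    (L.U g : H →L[ℂ] H) * L.A v Δ * ((L.U g)⁻¹ : unitary (H →L[ℂ] H)) = L.A v (b +ᵥ Δ) := by
  rw [L.covariant g v hv P hP Δ hΔ hm, hg, tensorAction_translation]
  rfl

/-- The same relation for the functional calculus of the effects. -/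
lemma LocalizationObservable.conj_cfc_translation (L : LocalizationObservable π H) {g : G}
    {b : Spacetime} (hg : π g = translation b) {v : Tensor L.p L.q} (hv : v ∈ L.S)
    {P : AffineSubspace ℝ Spacetime} (hP : IsSpacelikePlane P) {Δ : Set Spacetime} (hΔ : Δ ⊆ P)
    (hm : MeasurableSet Δ) {f : ℝ → ℝ} (hf : Continuous f) :
    (L.U g : H →L[ℂ] H) * cfc f (L.A v Δ) * ((L.U g)⁻¹ : unitary (H →L[ℂ] H))
      = cfc f (L.A v (b +ᵥ Δ)) := by
  rw [conj_cfc _ hf ((L.povm v hv P hP).isSelfAdjoint hΔ hm), L.covariant_translation hg hv hP hΔ hm]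

end Minkowski

/-! ### Microcausality and bounded energy exclude each other -/

namespace Minkowski

variable {G : Type*} [Group G] [TopologicalSpace G] {π : G →* OrthochronousPoincare}
  {H : Type*} [NormedAddCommGroup H] [InnerProductSpace ℂ H] [CompleteSpace H]

lemma Microcausal.exists_commute {L : LocalizationObservable π H} {v : Tensor L.p L.q}
    (hv : v ∈ L.S) {P : AffineSubspace ℝ Spacetime} (hP : IsSpacelikePlane P)
    (hM : Microcausal P (L.A v)) {u : Spacetime} (hu : FutureTimelike u)
    {V : ℝ → G} (hV : ∀ t, π (V t) = translation (t • u)) (hVneg : ∀ t, V (-t) = (V t)⁻¹)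
    {Δ Δ' : Set Spacetime} (hΔ : Δ ⊆ P) (hΔ' : Δ' ⊆ P) (hm : MeasurableSet Δ)
    (hm' : MeasurableSet Δ') (hb : Bornology.IsBounded Δ) (hb' : Bornology.IsBounded Δ')
    (hdisj : Disjoint Δ Δ') {d : ℝ} (hd : 0 < d)
    (hdist : ∀ x ∈ Δ, ∀ y ∈ Δ', d ≤ √(metric (x - y) (x - y))) :
    ∃ ε > (0 : ℝ), ∀ t : ℝ, |t| < ε → Commute (L.A v Δ) (L.A v ((t • u) +ᵥ Δ')) := by
  obtain ⟨δ₁, hδ₁, h₁⟩ := hM P (AffineSubspace.Parallel.refl P) Δ Δ' hΔ hΔ' hm hm' hb hb' hdisj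
    ⟨d, hd, hdist⟩ u hu
  obtain ⟨δ₂, hδ₂, h₂⟩ := hM P (AffineSubspace.Parallel.refl P) Δ' Δ hΔ' hΔ hm' hm hb' hb
    hdisj.symm ⟨d, hd, fun x hx y hy => by
      have := hdist y hy x hx
      have e : metric (x - y) (x - y) = metric (y - x) (y - x) := by
        simp only [metric, Pi.sub_apply]; ring
      rwa [e]⟩ u hu
  refine ⟨min δ₁ δ₂, lt_min hδ₁ hδ₂, fun t ht => ?_⟩
  rcases le_total 0 t with h0 | h0
  · rw [abs_of_nonneg h0] at ht
    exact h₁ t h0 (ht.trans_le (min_le_left _ _))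
  · -- for negative times, exchange the two regions and translate both
    rw [abs_of_nonpos h0] at ht
    have hc := h₂ (-t) (by linarith) (ht.trans_le (min_le_right _ _))
    rw [← L.covariant_translation (hV (-t)) hv hP hΔ hm, hVneg, map_inv, inv_inv] at hc
    have h3 := hc.map (Unitary.conjStarAlgAut ℂ (H →L[ℂ] H) (L.U (V t)))
    rw [← L.covariant_translation (hV t) hv hP hΔ' hm']
    have h4 : Unitary.conjStarAlgAut ℂ (H →L[ℂ] H) (L.U (V t))
        (((L.U (V t))⁻¹ : unitary (H →L[ℂ] H)) * L.A v Δ * (L.U (V t) : H →L[ℂ] H))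
        = L.A v Δ := by
      rw [Unitary.conjStarAlgAut_apply]
      have h5 : (L.U (V t) : H →L[ℂ] H) * ((L.U (V t))⁻¹ : unitary (H →L[ℂ] H)) = 1 := by
        rw [← Submonoid.coe_mul, mul_inv_cancel, Submonoid.coe_one]
      have h6 : (star (L.U (V t)) : H →L[ℂ] H) = ((L.U (V t))⁻¹ : unitary (H →L[ℂ] H)) := rfl
      rw [h6]
      simp only [← mul_assoc, h5, one_mul]
      rw [mul_assoc, h5, mul_one]
    rw [h4] at h3
    exact h3.symm

/-- The part of a Borel set in a large ball. -/
def truncate (X : Set Spacetime) (n : ℕ) : Set Spacetime := {x ∈ X | ⌊‖x‖⌋₊ < n}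

lemma truncate_subset (X : Set Spacetime) (n : ℕ) : truncate X n ⊆ X := Set.sep_subset _ _

lemma norm_lt_of_mem_truncate {X : Set Spacetime} {n : ℕ} {x : Spacetime}
    (hx : x ∈ truncate X n) : ‖x‖ < n := (Nat.floor_lt (norm_nonneg x)).1 hx.2

lemma isBounded_truncate (X : Set Spacetime) (n : ℕ) : Bornology.IsBounded (truncate X n) :=
  Metric.isBounded_ball.subset fun _ hx => mem_ball_zero_iff.2 (norm_lt_of_mem_truncate hx)

lemma measurableSet_truncate {X : Set Spacetime} (hX : MeasurableSet X) (n : ℕ) :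
    MeasurableSet (truncate X n) :=
  hX.inter ((Nat.measurable_floor.comp measurable_norm) measurableSet_Iio)

/-- Conjugation does not see a phase. -/
lemma phase_conj {G : Type*} [Group G] {U : G →* unitary (H →L[ℂ] H)} {V : ℝ → G}
    (hVneg : ∀ t, V (-t) = (V t)⁻¹) (c t : ℝ) (F : H →L[ℂ] H) :
    (Complex.exp (Complex.I * c * t) • (U (V t) : H →L[ℂ] H)) * F *
      (Complex.exp (Complex.I * c * (-t : ℝ)) • (U (V (-t)) : H →L[ℂ] H))
      = (U (V t) : H →L[ℂ] H) * F * ((U (V t))⁻¹ : unitary (H →L[ℂ] H)) := by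
  rw [hVneg, map_inv, smul_mul_assoc, smul_mul_smul_comm, ← Complex.exp_add]
  simp

/-- The spectral cut-offs of the effects of a bounded region and of its translate by `a + t u` are
orthogonal, for any `t`, if the spacelike translation `a` in the leaf is large: this is Borchers'
lemma. -/
lemma Microcausal.cfc_excess_mul_cfc_excess {L : LocalizationObservable π H} {v : Tensor L.p L.q}
    (hv : v ∈ L.S) {P : AffineSubspace ℝ Spacetime} (hP : IsSpacelikePlane P)
    (hM : Microcausal P (L.A v)) {u : Spacetime} (hu : FutureTimelike u)
    {V : ℝ → G} (hV : ∀ t, π (V t) = translation (t • u)) (hVneg : ∀ t, V (-t) = (V t)⁻¹)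
    {c : ℝ} {R : H →L[ℂ] H} (hW : IsPositiveGroup
      (fun t : ℝ => Complex.exp (Complex.I * c * t) • (L.U (V t) : H →L[ℂ] H)) R)
    (n : ℕ) {a : Spacetime} (ha : a ∈ P.direction) (han : 2 * n + 1 ≤ ‖a‖) (t : ℝ) :
    cfc excess (L.A v (truncate P n)) * cfc excess (L.A v ((t • u + a) +ᵥ truncate P n)) = 0 := by
  have hPm : MeasurableSet (P : Set Spacetime) :=
    (AffineSubspace.closed_of_finiteDimensional P).measurableSet
  set Δ := truncate P n
  have hΔ : Δ ⊆ P := truncate_subset _ _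
  have hm : MeasurableSet Δ := measurableSet_truncate hPm n
  have hΔ' : a +ᵥ Δ ⊆ P := by
    rintro _ ⟨x, hx, rfl⟩
    exact AffineSubspace.vadd_mem_of_mem_direction ha (hΔ hx)
  have hm' : MeasurableSet (a +ᵥ Δ) := hm.const_vadd a
  have hb : Bornology.IsBounded Δ := isBounded_truncate _ _
  have hb' : Bornology.IsBounded (a +ᵥ Δ) := hb.vadd a
  obtain ⟨κ, hκ, hle⟩ := hP.exists_le_metric
  have hdist : ∀ x ∈ Δ, ∀ y ∈ a +ᵥ Δ, √κ ≤ √(metric (x - y) (x - y)) := by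
    intro x hx y hy
    have hxy : x - y ∈ P.direction := AffineSubspace.vsub_mem_direction (hΔ hx) (hΔ' hy)
    obtain ⟨z, hz, rfl⟩ := hy
    have h1 : 1 ≤ ‖x - (a +ᵥ z)‖ := by
      have e : a = (x - z) - (x - (a +ᵥ z)) := by rw [vadd_eq_add]; abel
      have h2 := norm_sub_le (x - z) (x - (a +ᵥ z))
      rw [← e] at h2
      have h3 := norm_sub_le x z
      linarith [norm_lt_of_mem_truncate hx, norm_lt_of_mem_truncate hz]
    refine Real.sqrt_le_sqrt (le_trans ?_ (hle _ hxy))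
    exact le_mul_of_one_le_right hκ.le (one_le_pow₀ h1)
  have hdisj : Disjoint Δ (a +ᵥ Δ) := Set.disjoint_left.2 fun x hx hx' => by
    have := hdist x hx x hx'
    simp only [sub_self, metric, Pi.zero_apply, mul_zero, neg_zero, add_zero, Real.sqrt_zero]
      at this
    exact absurd (Real.sqrt_pos.2 hκ) (not_lt.2 this)
  obtain ⟨ε, hε, hcomm⟩ := hM.exists_commute hv hP hu hV hVneg hΔ hΔ' hm hm' hb hb' hdisj
    (Real.sqrt_pos.2 hκ) hdist
  have hE := L.povm v hv P hP
  have hA : IsSelfAdjoint (L.A v Δ) := hE.isSelfAdjoint hΔ hm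
  have hA' : IsSelfAdjoint (L.A v (a +ᵥ Δ)) := hE.isSelfAdjoint hΔ' hm'
  have hconj : ∀ t : ℝ, (L.U (V t) : H →L[ℂ] H) * cfc excess (L.A v (a +ᵥ Δ)) *
      ((L.U (V t))⁻¹ : unitary (H →L[ℂ] H)) = cfc excess (L.A v ((t • u) +ᵥ (a +ᵥ Δ))) :=
    fun t => L.conj_cfc_translation (hV t) hv hP hΔ' hm' continuous_excess
  have hcfc : ∀ (f : ℝ → ℝ) (t : ℝ), |t| < ε → Commute (cfc f (L.A v Δ))
      (cfc excess (L.A v ((t • u) +ᵥ (a +ᵥ Δ)))) := fun f t ht => by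
    rw [← hconj, conj_cfc _ continuous_excess hA', L.covariant_translation (hV t) hv hP hΔ' hm']
    have h1 : Commute (cfc f (L.A v Δ)) (L.A v ((t • u) +ᵥ (a +ᵥ Δ))) :=
      Commute.cfc (hcomm t ht) (by rw [hA.star_eq]; exact hcomm t ht) f
    have hA'' : IsSelfAdjoint (L.A v ((t • u) +ᵥ (a +ᵥ Δ))) := by
      rw [← L.covariant_translation (hV t) hv hP hΔ' hm']
      exact hA'.conjugate (L.U (V t) : H →L[ℂ] H)
    exact (Commute.cfc h1.symm (by rw [hA''.star_eq]; exact h1.symm) _).symm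
  have h0 : Commute (L.A v Δ) (L.A v (a +ᵥ Δ)) := by
    have := hcomm 0 (by simpa using hε)
    rwa [zero_smul, zero_vadd] at this
  have key := hW.mul_conj_eq_zero_of_commute (e := cfc plateau (L.A v Δ))
    (e' := cfc excess (L.A v Δ)) (F := cfc excess (L.A v (a +ᵥ Δ))) hε (norm_cfc_plateau_le _)
    (cfc_excess_mul_cfc_plateau _)
    (cfc_plateau_mul_cfc_excess hA hA' h0
      (hE.re_inner_add_le hΔ hΔ' hm hm' hdisj))
    (fun t ht => by rw [phase_conj hVneg, hconj]; exact hcfc _ t ht)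
    (fun t ht => by rw [phase_conj hVneg, hconj]; exact hcfc _ t ht) t
  rwa [phase_conj hVneg, hconj, vadd_vadd] at key

theorem LocalizationObservable.not_microcausal [Nontrivial H] (hπ : IsSymmetryGroup π)
    (L : LocalizationObservable π H) {u : Spacetime} (hu : FutureTimelike u)
    (hE : EnergyBoundedBelow π L.U u) {v : Tensor L.p L.q} (hv : v ∈ L.S)
    {P : AffineSubspace ℝ Spacetime} (hP : IsSpacelikePlane P) : ¬ Microcausal P (L.A v) := by
  intro hM
  obtain ⟨γ, hγ, hγπ, hbdd⟩ := hE
  set V : ℝ → G := fun t => γ (Multiplicative.ofAdd t)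
  have hVadd : ∀ s t, V (s + t) = V s * V t := fun s t => by
    simp only [V, ofAdd_add, map_mul]
  have hV0 : V 0 = 1 := by simp only [V, ofAdd_zero, map_one]
  have hVneg : ∀ t, V (-t) = (V t)⁻¹ := fun t => by simp only [V, ofAdd_neg, map_inv]
  obtain ⟨c, R, hW⟩ := exists_isPositiveGroup (W := fun t => (L.U (V t) : H →L[ℂ] H))
    (by simp [hV0]) (fun s t => by simp [hVadd]) (fun t ψ => Unitary.norm_map (L.U (V t)) ψ)
    (fun ψ => (L.strongly_continuous ψ).comp (hγ.comp continuous_ofAdd)) hbdd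
  have hPm : MeasurableSet (P : Set Spacetime) :=
    (AffineSubspace.closed_of_finiteDimensional P).measurableSet
  obtain ⟨n, hn⟩ := (L.povm v hv P hP).exists_cfc_excess_ne_zero hPm
  set Δ := truncate P n
  change cfc excess (L.A v Δ) ≠ 0 at hn
  set e : H →L[ℂ] H := cfc excess (L.A v Δ)
  -- the translations along `Λ u`, with `Λ` the linear part of `π g`, have components in the leaf
  obtain ⟨g, hg⟩ := exists_map_linear_ne_smul hπ hu
  obtain ⟨a, ha, k, hak⟩ := hP.exists_mem_direction_add_smul hu ((π g).1.linear u)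
  have ha0 : a ≠ 0 := by
    rintro rfl
    exact hg k (by rw [hak, zero_add])
  have hana : 0 < ‖a‖ := norm_pos_iff.2 ha0
  set Ug : H →L[ℂ] H := (L.U g : H →L[ℂ] H)
  set Ug' : H →L[ℂ] H := (((L.U g)⁻¹ : unitary (H →L[ℂ] H)) : H →L[ℂ] H)
  have hfar : ∀ s : ℝ, (2 * n + 1) / ‖a‖ ≤ s →
      e * Ug * (L.U (V s) : H →L[ℂ] H) * (Ug' * e) = 0 := by
    intro s hs
    have hs0 : 0 ≤ s := le_trans (by positivity) hs
    have h1 := hM.cfc_excess_mul_cfc_excess hv hP hu hγπ hVneg hW n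
      (P.direction.smul_mem s ha) (by
        rw [norm_smul, Real.norm_of_nonneg hs0]
        exact (div_le_iff₀ hana).1 hs) (s * k)
    have hgs : π (g * V s * g⁻¹) = translation ((s * k) • u + s • a) := by
      rw [map_mul, map_mul, map_inv, hγπ, conj_translation, map_smul, hak]
      congr 1
      module
    rw [← L.conj_cfc_translation hgs hv hP (truncate_subset _ _)
      (measurableSet_truncate hPm n) continuous_excess] at h1
    have h2 := congrArg (· * (L.U (g * V s * g⁻¹) : H →L[ℂ] H)) h1
    simp only [zero_mul, mul_assoc] at h2
    rw [← Submonoid.coe_mul, inv_mul_cancel, Submonoid.coe_one, mul_one] at h2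
    rw [map_mul, map_mul, map_inv, Submonoid.coe_mul, Submonoid.coe_mul] at h2
    simpa only [mul_assoc] using h2
  have hall := hW.mul_mul_eq_zero (X := e * Ug) (Y := Ug' * e)
    (lt_add_one ((2 * n + 1) / ‖a‖)) (fun s hs => by
      rw [mul_smul_comm, smul_mul_assoc, hfar s hs.1.le, smul_zero]) 0
  rw [hW.zero, mul_one] at hall
  have hUU : Ug * Ug' = 1 := by
    rw [← Submonoid.coe_mul, mul_inv_cancel, Submonoid.coe_one]
  have hee : e * e = 0 := by
    calc e * e = e * (Ug * Ug') * e := by rw [hUU, mul_one]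
      _ = e * Ug * (Ug' * e) := by simp only [mul_assoc]
      _ = 0 := hall
  have he : IsSelfAdjoint e := cfc_predicate _ _
  refine hn (CStarRing.star_mul_self_eq_zero_iff e |>.1 ?_)
  rw [he.star_eq, hee]

end Minkowski

theorem corollary2p1
    {G : Type*} [Group G] [TopologicalSpace G] [IsTopologicalGroup G]
    (π : G →* Minkowski.OrthochronousPoincare) (hπ : Minkowski.IsSymmetryGroup π)
    {H : Type*} [NormedAddCommGroup H] [InnerProductSpace ℂ H] [CompleteSpace H] [Nontrivial H]
    (L : Minkowski.LocalizationObservable π H)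
    (u : Minkowski.Spacetime) (hu : Minkowski.FutureTimelike u)
    (hE : Minkowski.EnergyBoundedBelow π L.U u)
    (v : Minkowski.Tensor L.p L.q) (hv : v ∈ L.S)
    (P₀ : AffineSubspace ℝ Minkowski.Spacetime) (hP₀ : Minkowski.IsSpacelikePlane P₀) :
    ¬ Minkowski.Microcausal P₀ (L.A v) :=
  L.not_microcausal hπ hu hE hv hP₀
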